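/- Let $L>0$, $\Omega=[0,L]^2$, and let $\mathcal V$ be the set of $\mathbb R^2$-valued, $\Omega$-periodic, divergence-free trigonometric polynomials with zero average over $\Omega$. Let $H$ be the closure of $\mathcal V$ in $L^2(\Omega)^2$ and $V$ the closure of $\mathcal V$ in $H^1(\Omega)^2$, with the norm $\|u\|=\big(\int_\Omega|\nabla u|^2\,dx\big)^{1/2}$ on $V$. Define $A:V\to V'$ and $B:V\times V\to V'$ by $$\langle Au,\varphi\rangle=\int_\Omega\sum_{j=1}^2\partial_ju\cdot\partial_j\varphi\,dx,\qquad \langle B(u,v),\varphi\rangle=\int_\Omega\big((u\cdot\nabla)v\big)\cdot\varphi\,dx ,$$ put $B_{\rm s}(u,v)=B(u,v)+B(v,u)$, and regard $H\subset V'$ through the $L^2$ inner product. Let $g\in H\setminus\{0\}$, $\alpha_n>0$, $\alpha_n\to\infty$, and let $v_n\in V$ satisfy $Av_n+\alpha_nB(v_n,v_n)=g$ in $V'$ for every $n$. *Expansions.* Let $v\in V$, $\mathcal N=\{k\in\mathbb N:1\le k\le N\}$ with $N\in\{0,1,2,\dots\}\cup\{\infty\}$, $w_k\in V$ and $\Gamma_{k,n}>0$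 for $k\in\mathcal N$. A relaxed expansion $v_n\approx v+\sum_{k\in\mathcal N}\Gamma_{k,n}w_k$ in $V$ means the following. If $N=0$ (the trivial expansion), $v_n=v$ for all $n$. If $N\ge1$, then $\Gamma_{1,n}\to0$ and $\Gamma_{k+1,n}/\Gamma_{k,n}\to0$ as $n\to\infty$ whenever $k,k+1\in\mathcal N$, and there are $w_n^{(k)}\in V$ with $w_n^{(k)}\to w_k$ in $V$ as $n\to\infty$ and $v_n=v+\sum_{j=1}^{k-1}\Gamma_{j,n}w_j+\Gamma_{k,n}w^{(k)}_n$ for all $n$ and $k\in\mathcal N$; if moreover $N<\infty$, then also $w^{(N)}_n=w_N$ for all $n$, and $w_N\neq0$. The expansion is unitary if $\|w_k\|=1$ for all $k\in\mathcal N$. It is degenerate if $N=\infty$ and there is an integer $M\ge0$ such that $\|w_k\|=1$ for $1\le k\le M$ and $w_k=0$ for $k>M$. *Comparison.* For sequences of positive numbers, $\xi_n\succ\eta_n$ means $\xi_n/\eta_n\to\infty$, and $\xi_n\sim\eta_n$ means $\xi_n/\eta_n\to\lambda$ for some $\lambda\in(0,\infty)$. **Theorem 4.7.** Let $v_n\approx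 v+\sum_{k\in\mathcal N}\Gamma_{k,n}w_k$ be a unitary or degenerate expansion in $V$. Assume that any two of the sequences $(\alpha_n)$, $(1)$, $(\Gamma_{k,n})$, $(\alpha_n\Gamma_{k,n})$, $(\alpha_n\Gamma_{j,n}\Gamma_{k,n})$, $j,k\in\mathcal N$, are comparable, i.e. related by $\sim$, or by $\succ$ in one of the two orders. Suppose that $v=A^{-1}g$ and that the expansion is not a trivial unitary expansion, i.e. $N\ge1$. Then $$B_{\rm s}(v,w_1)=0,$$ and $w_2$ exists, i.e. $N\ge2$. Moreover, at least one of the following scenarios (i)–(vi) always occurs, and each has the stated consequence, where equations are in $V'$: (i) If $\Gamma_{1,n}\succ\alpha_n\Gamma_{2,n}$ and $\Gamma_{1,n}\succ\alpha_n\Gamma_{1,n}^2$, or if $\Gamma_{1,n}\sim\alpha_n\Gamma_{1,n}^2\succ\alpha_n\Gamma_{2,n}$, then $N=\infty$, $w_k=0$ for all $k\ge1$, and $v_n\approx v+\sum_{k=1}^\infty\Gamma_{k,n}\cdot0$ is a degenerate expansion in $V$. (ii) If $\alpha_n\Gamma_{2,n}\succ\Gamma_{1,n}$ and $\alpha_n\Gamma_{2,n}\succ\alpha_n\Gamma_{1,n}^2$,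 then $B_{\rm s}(v,w_2)=0$. (iii) If $\alpha_n\Gamma_{1,n}^2\succ\alpha_n\Gamma_{2,n}$ and $\alpha_n\Gamma_{1,n}^2\succ\Gamma_{1,n}$, then $B(w_1,w_1)=0$. (iv) If $\Gamma_{1,n}\sim\alpha_n\Gamma_{2,n}\succ\alpha_n\Gamma_{1,n}^2$, then $Aw_1+\mu B_{\rm s}(v,w_2)=0$ for some $\mu>0$. (v) If $\alpha_n\Gamma_{2,n}\sim\alpha_n\Gamma_{1,n}^2\succ\Gamma_{1,n}$, then $B_{\rm s}(v,w_2)+\mu B(w_1,w_1)=0$ for some $\mu>0$. (vi) If $\Gamma_{1,n}\sim\alpha_n\Gamma_{2,n}\sim\alpha_n\Gamma_{1,n}^2$, then $Aw_1+\mu_1B_{\rm s}(v,w_2)+\mu_2B(w_1,w_1)=0$ for some $\mu_1,\mu_2>0$. -/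

import Mathlib

open MeasureTheory Filter Topology

noncomputable section

/-! ## Asymptotic expansions in a normed space -/

section Expansions

variable {Z : Type*} [NormedAddCommGroup Z] [NormedSpace ℝ Z]

/-- `u n ≈ v + ∑ Γ k n • w k` is a relaxed expansion in `Z`, where `k` runs over the natural numbers
with `1 ≤ k ≤ N`: the expansion is trivial for `N = 0`, finite and nontrivial for
`1 ≤ N < ⊤`, and infinite for `N = ⊤`. The values of `w k`, `Γ k` for other `k` are irrelevant.
Here `r k n` is the normalized remainder (usually written `w_n^{(k)}`). -/
structure IsRelaxedExpansionWith (u : ℕ → Z) (N : ℕ∞) (v : Z) (w : ℕ → Z) (Γ : ℕ → ℕ → ℝ)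
    (r : ℕ → ℕ → Z) : Prop where
  trivial_case : N = 0 → ∀ n, u n = v
  Γ_pos : ∀ k : ℕ, 1 ≤ k → (k : ℕ∞) ≤ N → ∀ n, 0 < Γ k n
  Γ_one : 1 ≤ N → Tendsto (Γ 1) atTop (𝓝 0)
  Γ_succ : ∀ k : ℕ, 1 ≤ k → (k : ℕ∞) < N → Tendsto (fun n => Γ (k + 1) n / Γ k n) atTop (𝓝 0)
  rem_tendsto : ∀ k : ℕ, 1 ≤ k → (k : ℕ∞) ≤ N → Tendsto (r k) atTop (𝓝 (w k))
  expand : ∀ k : ℕ, 1 ≤ k → (k : ℕ∞) ≤ N → ∀ n,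
    u n = v + ∑ j ∈ Finset.Ico 1 k, Γ j n • w j + Γ k n • r k n
  rem_last : ∀ K : ℕ, 1 ≤ K → N = K → ∀ n, r K n = w K
  last_ne_zero : ∀ K : ℕ, 1 ≤ K → N = K → w K ≠ 0

/-- `u n ≈ v + ∑ Γ k n • w k` is a relaxed expansion in `Z`. -/
def IsRelaxedExpansion (u : ℕ → Z) (N : ℕ∞) (v : Z) (w : ℕ → Z) (Γ : ℕ → ℕ → ℝ) : Prop :=
  ∃ r : ℕ → ℕ → Z, IsRelaxedExpansionWith u N v w Γ r

/-- A unitary expansion: a relaxed expansion all of whose vectors `w k` are unit vectors. -/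
def IsUnitaryExpansion (u : ℕ → Z) (N : ℕ∞) (v : Z) (w : ℕ → Z) (Γ : ℕ → ℕ → ℝ) : Prop :=
  IsRelaxedExpansion u N v w Γ ∧ ∀ k : ℕ, 1 ≤ k → (k : ℕ∞) ≤ N → ‖w k‖ = 1

/-- A degenerate expansion: an infinite relaxed expansion in which `w 1, …, w M` are unit vectors and
all later `w k` vanish, for some `M ≥ 0` (for `M = 0` all the `w k` vanish). -/
def IsDegenerateExpansion (u : ℕ → Z) (v : Z) (w : ℕ → Z) (Γ : ℕ → ℕ → ℝ) : Prop :=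
  IsRelaxedExpansion u ⊤ v w Γ ∧
    ∃ M : ℕ, (∀ k : ℕ, 1 ≤ k → k ≤ M → ‖w k‖ = 1) ∧ ∀ k : ℕ, M < k → w k = 0

end Expansions

/-! ## Comparison of sequences of positive numbers -/

/-- `ξ ≻ η`: the quotient `ξ n / η n` tends to infinity. -/
def SeqDominates (ξ η : ℕ → ℝ) : Prop := Tendsto (fun n => ξ n / η n) atTop atTop

/-- `ξ ∼ η`: the quotient `ξ n / η n` tends to a positive real number. -/
def SeqEquiv (ξ η : ℕ → ℝ) : Prop :=
  ∃ c : ℝ, 0 < c ∧ Tendsto (fun n => ξ n / η n) atTop (𝓝 c)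

def TotallyComparable (X : Set (ℕ → ℝ)) : Prop :=
  ∀ ξ ∈ X, ∀ η ∈ X, SeqEquiv ξ η ∨ SeqDominates ξ η ∨ SeqDominates η ξ

/-- The sequences `α`, `1`, `Γ k`, `α Γ k`, `α Γ j Γ k` for `1 ≤ j, k ≤ N`. -/
def coefficientSequences (α : ℕ → ℝ) (N : ℕ∞) (Γ : ℕ → ℕ → ℝ) : Set (ℕ → ℝ) :=
  {ξ | ξ = α ∨ ξ = (fun _ => 1) ∨
    (∃ k : ℕ, 1 ≤ k ∧ (k : ℕ∞) ≤ N ∧ (ξ = Γ k ∨ ξ = fun n => α n * Γ k n)) ∨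
    ∃ j k : ℕ, 1 ≤ j ∧ (j : ℕ∞) ≤ N ∧ 1 ≤ k ∧ (k : ℕ∞) ≤ N ∧ ξ = fun n => α n * Γ j n * Γ k n}

/-! ## The function spaces `H` and `V` of the two-dimensional periodic problem -/

namespace NSE

/-- The plane as the domain of the space variable. -/
abbrev Plane := Fin 2 → ℝ

/-- The values of a velocity field. -/
abbrev Vec := EuclideanSpace ℝ (Fin 2)

/-- The square `[0, L]²`. -/
def box (L : ℝ) : Set Plane := Set.Icc 0 (fun _ => L)

/-- Lebesgue measure on `[0, L]²`. -/
abbrev boxMeasure (L : ℝ) : Measure Plane := volume.restrict (box L)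

/-- The space `L²(Ω)²` with its usual inner product, `Ω = [0, L]²`. -/
abbrev L2 (L : ℝ) := Lp Vec 2 (boxMeasure L)

/-- The partial derivative `∂ u / ∂ x_j`. -/
def pderiv (j : Fin 2) (u : Plane → Vec) (x : Plane) : Vec := fderiv ℝ u x (Pi.single j 1)

def phase (L : ℝ) (k : Fin 2 → ℤ) (x : Plane) : ℝ := 2 * Real.pi / L * ∑ i, (k i : ℝ) * x i

/-- The `ℝ²`-valued trigonometric polynomials that are `L`-periodic in each variable. -/
def trigPoly (L : ℝ) : Submodule ℝ (Plane → Vec) :=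
  Submodule.span ℝ {f | ∃ (k : Fin 2 → ℤ) (a : Vec),
    f = (fun x => Real.cos (phase L k x) • a) ∨ f = (fun x => Real.sin (phase L k x) • a)}

theorem contDiff_phase (L : ℝ) (k : Fin 2 → ℤ) : ContDiff ℝ ⊤ (phase L k) := by
  unfold phase; fun_prop

theorem trigPoly_contDiff {L : ℝ} {u : Plane → Vec} (hu : u ∈ trigPoly L) : ContDiff ℝ ⊤ u := by
  refine Submodule.span_induction (p := fun u _ => ContDiff ℝ ⊤ u) ?_ ?_ ?_ ?_ hu
  · rintro f ⟨k, a, rfl | rfl⟩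
    · exact (Real.contDiff_cos.comp (contDiff_phase L k)).smul contDiff_const
    · exact (Real.contDiff_sin.comp (contDiff_phase L k)).smul contDiff_const
  · exact contDiff_const
  · intro f g _ _ hf hg; exact hf.add hg
  · intro c f _ hf; exact contDiff_const.smul hf

theorem trigPoly_differentiable {L : ℝ} {u : Plane → Vec} (hu : u ∈ trigPoly L) :
    Differentiable ℝ u := (trigPoly_contDiff hu).differentiable (by simp)

theorem continuous_integrable {L : ℝ} {F : Type*} [NormedAddCommGroup F] {u : Plane → F}
    (hu : Continuous u) : Integrable u (boxMeasure L) :=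
  hu.continuousOn.integrableOn_compact isCompact_Icc

theorem pderiv_add {j : Fin 2} {u w : Plane → Vec} (hu : Differentiable ℝ u)
    (hw : Differentiable ℝ w) : pderiv j (u + w) = pderiv j u + pderiv j w := by
  funext x; simp [pderiv, fderiv_add (hu x) (hw x)]

theorem pderiv_smul {j : Fin 2} {u : Plane → Vec} (c : ℝ) (hu : Differentiable ℝ u) :
    pderiv j (c • u) = c • pderiv j u := by
  funext x; simp [pderiv, fderiv_const_smul (hu x) c]

theorem pderiv_zero {j : Fin 2} : pderiv j (0 : Plane → Vec) = 0 := by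
  funext x; simp [pderiv]

/-- The trigonometric polynomials that are divergence-free and have zero average over `[0, L]²`. -/
def solenoidal (L : ℝ) : Submodule ℝ (Plane → Vec) where
  carrier := {u | u ∈ trigPoly L ∧ (∀ x, ∑ j, pderiv j u x j = 0) ∧ ∫ x in box L, u x = 0}
  zero_mem' := ⟨zero_mem _, by simp [pderiv_zero], by simp⟩
  add_mem' := by
    rintro u w ⟨hu, hu', hu''⟩ ⟨hw, hw', hw''⟩
    have du := trigPoly_differentiable hu
    have dw := trigPoly_differentiable hw
    refine ⟨add_mem hu hw, fun x => ?_, ?_⟩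
    · simp only [pderiv_add du dw, Pi.add_apply, PiLp.add_apply, Finset.sum_add_distrib, hu', hw',
        add_zero]
    · simp only [Pi.add_apply]
      rw [integral_add (continuous_integrable du.continuous) (continuous_integrable dw.continuous),
        hu'', hw'', add_zero]
  smul_mem' := by
    rintro c u ⟨hu, hu', hu''⟩
    have du := trigPoly_differentiable hu
    refine ⟨Submodule.smul_mem _ c hu, fun x => ?_, ?_⟩
    · simp only [pderiv_smul c du, Pi.smul_apply, PiLp.smul_apply, ← Finset.smul_sum, hu', smul_zero]
    · simp only [Pi.smul_apply]
      rw [integral_smul, hu'', smul_zero]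

/-- The divergence-free trigonometric polynomials of zero average, as elements of `L²(Ω)²`. -/
def solenoidalL2 (L : ℝ) : Submodule ℝ (L2 L) where
  carrier := {h | ∃ u ∈ solenoidal L, h =ᵐ[boxMeasure L] u}
  zero_mem' := ⟨0, zero_mem _, Lp.coeFn_zero _ _ _⟩
  add_mem' := by
    rintro h₁ h₂ ⟨u₁, hu₁, e₁⟩ ⟨u₂, hu₂, e₂⟩
    exact ⟨u₁ + u₂, add_mem hu₁ hu₂, (Lp.coeFn_add h₁ h₂).trans (e₁.add e₂)⟩
  smul_mem' := by
    rintro c h ⟨u, hu, e⟩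
    exact ⟨c • u, Submodule.smul_mem _ c hu, (Lp.coeFn_smul c h).trans (e.const_smul c)⟩

/-- `H` is the closure of the divergence-free trigonometric polynomials of zero average in
`L²(Ω)²`. -/
def H (L : ℝ) : Submodule ℝ (L2 L) := (solenoidalL2 L).topologicalClosure

/-- The triples `(u, ∂₁ u, ∂₂ u)` of elements of `L²(Ω)²`, for `u` a divergence-free trigonometric
polynomial of zero average. -/
def solenoidalH1 (L : ℝ) : Submodule ℝ (L2 L × PiLp 2 fun _ : Fin 2 => L2 L) where
  carrier := {h | ∃ u ∈ solenoidal L, h.1 =ᵐ[boxMeasure L] u ∧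
    ∀ j, h.2 j =ᵐ[boxMeasure L] pderiv j u}
  zero_mem' := ⟨0, zero_mem _, Lp.coeFn_zero _ _ _, fun j => by
    rw [pderiv_zero]; exact Lp.coeFn_zero _ _ _⟩
  add_mem' := by
    rintro h₁ h₂ ⟨u₁, hu₁, e₁, d₁⟩ ⟨u₂, hu₂, e₂, d₂⟩
    refine ⟨u₁ + u₂, add_mem hu₁ hu₂, (Lp.coeFn_add h₁.1 h₂.1).trans (e₁.add e₂), fun j => ?_⟩
    rw [pderiv_add (trigPoly_differentiable hu₁.1) (trigPoly_differentiable hu₂.1)]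
    exact (Lp.coeFn_add (h₁.2 j) (h₂.2 j)).trans ((d₁ j).add (d₂ j))
  smul_mem' := by
    rintro c h ⟨u, hu, e, d⟩
    refine ⟨c • u, Submodule.smul_mem _ c hu, (Lp.coeFn_smul c h.1).trans (e.const_smul c),
      fun j => ?_⟩
    rw [pderiv_smul c (trigPoly_differentiable hu.1)]
    exact (Lp.coeFn_smul c (h.2 j)).trans ((d j).const_smul c)

/-- `V` is the closure of the divergence-free trigonometric polynomials of zero average in
`H¹(Ω)²`. An element `u` of `H¹(Ω)²` is written as `(u, (∂₁ u, ∂₂ u))`, with the weak partial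
derivatives; convergence in `H¹` is convergence in `L²` of all three components. -/
def V (L : ℝ) : Type := (solenoidalH1 L).topologicalClosure

instance (L : ℝ) : AddCommGroup (V L) :=
  inferInstanceAs (AddCommGroup (solenoidalH1 L).topologicalClosure)

instance (L : ℝ) : Module ℝ (V L) :=
  inferInstanceAs (Module ℝ (solenoidalH1 L).topologicalClosure)

/-- The inclusion of `V` in `L²(Ω)²`. -/
def V.toL2 (L : ℝ) : V L →ₗ[ℝ] L2 L :=
  LinearMap.fst ℝ (L2 L) (PiLp 2 fun _ : Fin 2 => L2 L) ∘ₗ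
    (solenoidalH1 L).topologicalClosure.subtype

/-- The gradient `u ↦ (∂₁ u, ∂₂ u)` on `V`. -/
def V.grad (L : ℝ) : V L →ₗ[ℝ] PiLp 2 fun _ : Fin 2 => L2 L :=
  LinearMap.snd ℝ (L2 L) (PiLp 2 fun _ : Fin 2 => L2 L) ∘ₗ
    (solenoidalH1 L).topologicalClosure.subtype

theorem phase_add (L : ℝ) (hL : 0 < L) (k : Fin 2 → ℤ) (x : Plane) (j : Fin 2) :
    phase L k (x + Pi.single j L) = phase L k x + k j * (2 * Real.pi) := by
  have h : ∑ i, (k i : ℝ) * (x + Pi.single j L : Plane) i = ∑ i, (k i : ℝ) * x i + k j * L := by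
    simp only [Pi.add_apply, mul_add, Finset.sum_add_distrib, Pi.single_apply, mul_ite, mul_zero,
      Finset.sum_ite_eq', Finset.mem_univ, if_true]
  unfold phase
  rw [h]; field_simp

theorem trigPoly_periodic {L : ℝ} (hL : 0 < L) {u : Plane → Vec} (hu : u ∈ trigPoly L) (j : Fin 2)
    (x : Plane) : u (x + Pi.single j L) = u x := by
  refine Submodule.span_induction (p := fun u _ => u (x + Pi.single j L) = u x) ?_ ?_ ?_ ?_ hu
  · rintro f ⟨k, a, rfl | rfl⟩
    · simp only [phase_add L hL, Real.cos_add_int_mul_two_pi]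
    · simp only [phase_add L hL, Real.sin_add_int_mul_two_pi]
  · rfl
  · intro f g _ _ hf hg; simp [hf, hg]
  · intro c f _ hf; simp [hf]

theorem integral_fderiv_periodic {L : ℝ} (hL : 0 < L) {F : Plane → ℝ} (hF : ContDiff ℝ 1 F)
    (j : Fin 2) (hp : ∀ x, F (x + Pi.single j L) = F x) :
    ∫ x in box L, fderiv ℝ F x (Pi.single j 1) = 0 := by
  classical
  have hd : Differentiable ℝ F := hF.differentiable (by simp)
  have hc : Continuous fun x => fderiv ℝ F x (Pi.single j 1) :=
    (hF.continuous_fderiv (by simp)).clm_apply continuous_const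
  have key := integral_divergence_of_hasFDerivAt_off_countable' (n := 1) (E := ℝ)
    (0 : Plane) (fun _ => L) (fun _ => hL.le) (fun i => if i = j then F else 0)
    (fun i x => if i = j then fderiv ℝ F x else 0) ∅ Set.countable_empty
    (fun i => by
      by_cases h : i = j
      · simpa [h] using hd.continuous.continuousOn
      · simpa [h] using! continuousOn_const)
    (fun x _ i => by
      by_cases h : i = j
      · simpa [h] using (hd x).hasFDerivAt
      · simpa [h] using! hasFDerivAt_const (0 : ℝ) x)
    (by
      have : (fun x => ∑ i, (if i = j then fderiv ℝ F x else 0) (Pi.single i 1 : Plane))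
          = fun x => fderiv ℝ F x (Pi.single j 1) := by
        funext x
        rw [Finset.sum_eq_single j] <;> simp +contextual
      rw [this]
      exact hc.continuousOn.integrableOn_compact isCompact_Icc)
  have e : ∀ x, ∑ i, (if i = j then fderiv ℝ F x else 0) (Pi.single i 1 : Plane)
      = fderiv ℝ F x (Pi.single j 1) := by
    intro x
    rw [Finset.sum_eq_single j] <;> simp +contextual
  simp only [e] at key
  unfold box
  rw [key]
  refine Finset.sum_eq_zero fun i _ => ?_
  by_cases h : i = j
  · subst h
    rw [sub_eq_zero]
    refine integral_congr_ae (Filter.Eventually.of_forall fun y => ?_)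
    simp only [if_true]
    rw [← hp (i.insertNth ((0 : Plane) i) y)]
    congr 1
    funext l
    rcases Fin.eq_self_or_eq_succAbove i l with rfl | ⟨l, rfl⟩ <;> simp
  · simp [h]

/-- Integration by parts against a Fourier mode. -/
theorem mode_parts {L : ℝ} (hL : 0 < L) {m m' : ℝ → ℝ} (hm : ContDiff ℝ 1 m)
    (hm' : ∀ t, HasDerivAt m (m' t) t) (hp : ∀ (t : ℝ) (n : ℤ), m (t + n * (2 * Real.pi)) = m t)
    (hc : Continuous m') (k : Fin 2 → ℤ) (a : Vec) (j : Fin 2) {u : Plane → Vec}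
    (hu : u ∈ trigPoly L) :
    (2 * Real.pi / L * k j) * (∫ x in box L, inner ℝ (m' (phase L k x) • a) (u x)) +
      ∫ x in box L, inner ℝ (m (phase L k x) • a) (pderiv j u x) = 0 := by
  have hu1 : ContDiff ℝ 1 u := (trigPoly_contDiff hu).of_le le_top
  have hph : ContDiff ℝ 1 (phase L k) := (contDiff_phase L k).of_le le_top
  have hF : ContDiff ℝ 1 fun x => inner ℝ (m (phase L k x) • a) (u x) :=
    ((hm.comp hph).smul contDiff_const).inner ℝ hu1
  have hz := integral_fderiv_periodic hL hF j (fun x => by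
    rw [trigPoly_periodic hL hu, phase_add L hL, hp])
  have hcu : Continuous (pderiv j u) :=
    (hu1.continuous_fderiv (by simp)).clm_apply continuous_const
  have i1 : Integrable (fun x => inner ℝ (m' (phase L k x) • a) (u x)) (boxMeasure L) :=
    continuous_integrable (((hc.comp hph.continuous).smul continuous_const).inner hu1.continuous)
  have i2 : Integrable (fun x => inner ℝ (m (phase L k x) • a) (pderiv j u x)) (boxMeasure L) :=
    continuous_integrable (((hm.continuous.comp hph.continuous).smul continuous_const).inner hcu)
  rw [← integral_const_mul, ← integral_add (i1.const_mul _) i2, ← hz]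
  refine integral_congr_ae (Filter.Eventually.of_forall fun x => ?_)
  have dph : HasFDerivAt (phase L k)
      ((2 * Real.pi / L) • ∑ i, (k i : ℝ) • ContinuousLinearMap.proj (R := ℝ) (φ := fun _ => ℝ) i)
      x := by
    unfold phase
    refine HasFDerivAt.const_mul ?_ _
    refine HasFDerivAt.fun_sum fun i _ => ?_
    exact ((ContinuousLinearMap.proj (R := ℝ) (φ := fun _ : Fin 2 => ℝ) i).hasFDerivAt).const_mul _
  have d1 := ((hm' (phase L k x)).comp_hasFDerivAt x dph).smul_const a
  have d2 := (d1.inner ℝ ((hu1.differentiable (by simp)) x).hasFDerivAt).fderiv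
  simp only [Function.comp_def] at d2
  simp only
  rw [d2]
  fin_cases j <;> simp [pderiv, inner_smul_left] <;> ring

theorem continuous_memLp {L : ℝ} {f : Plane → Vec} (hf : Continuous f) :
    MemLp f 2 (boxMeasure L) := by
  obtain ⟨C, hC⟩ := (isCompact_Icc : IsCompact (box L)).exists_bound_of_continuousOn hf.continuousOn
  have : IsFiniteMeasure (boxMeasure L) :=
    ⟨by rw [Measure.restrict_apply_univ]; exact isCompact_Icc.measure_lt_top⟩
  exact MemLp.of_bound hf.aestronglyMeasurable C
    ((ae_restrict_iff' measurableSet_Icc).2 (Filter.Eventually.of_forall fun x hx => hC x hx))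

theorem inner_toLp {L : ℝ} {f : Plane → Vec} (hf : Continuous f) (h : L2 L) {g : Plane → Vec}
    (hg : h =ᵐ[boxMeasure L] g) :
    inner ℝ ((continuous_memLp (L := L) hf).toLp f) h = ∫ x in box L, inner ℝ (f x) (g x) := by
  rw [MeasureTheory.L2.inner_def]
  refine integral_congr_ae ?_
  filter_upwards [hg, (continuous_memLp (L := L) hf).coeFn_toLp] with x h1 h2
  rw [h1, h2]

theorem mode_parts_closure {L : ℝ} (hL : 0 < L) {m m' : ℝ → ℝ} (hm : ContDiff ℝ 1 m)
    (hm' : ∀ t, HasDerivAt m (m' t) t) (hp : ∀ (t : ℝ) (n : ℤ), m (t + n * (2 * Real.pi)) = m t)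
    (hc : Continuous m') (k : Fin 2 → ℤ) (a : Vec)
    (c1 : Continuous fun x => m' (phase L k x) • a) (hk : k ≠ 0)
    {h : L2 L × PiLp 2 fun _ : Fin 2 => L2 L}
    (hh : h ∈ (solenoidalH1 L).topologicalClosure) (h0 : h.2 = 0) :
    inner ℝ ((continuous_memLp (L := L) c1).toLp _) h.1 = 0 := by
  obtain ⟨j, hj⟩ := Function.ne_iff.1 hk
  have c2 : Continuous fun x => m (phase L k x) • a :=
    (hm.continuous.comp (contDiff_phase L k).continuous).smul continuous_const
  have hcl : IsClosed {h : L2 L × PiLp 2 fun _ : Fin 2 => L2 L |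
      (2 * Real.pi / L * k j) * inner ℝ ((continuous_memLp (L := L) c1).toLp _) h.1 +
        inner ℝ ((continuous_memLp (L := L) c2).toLp _) (h.2 j) = 0} := by
    refine isClosed_eq ?_ continuous_const
    have : Continuous fun h : L2 L × PiLp 2 fun _ : Fin 2 => L2 L => h.2 j :=
      (PiLp.continuous_apply 2 _ j).comp continuous_snd
    exact (continuous_const.mul (continuous_const.inner continuous_fst)).add
      (continuous_const.inner this)
  have hmem := closure_minimal (s := (solenoidalH1 L : Set _)) (fun q hq => by
    obtain ⟨u, hu, e, d⟩ := hq
    simp only [Set.mem_ofPred_eq]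
    rw [inner_toLp c1 _ e, inner_toLp c2 _ (d j)]
    exact mode_parts hL hm hm' hp hc k a j hu.1) hcl hh
  simp only [Set.mem_ofPred_eq, h0] at hmem
  simp only [PiLp.zero_apply, inner_zero_right, add_zero] at hmem
  refine (mul_eq_zero.1 hmem).resolve_left ?_
  have : (k j : ℝ) ≠ 0 := by exact_mod_cast hj
  positivity

theorem average_closure {L : ℝ} (a : Vec) {h : L2 L × PiLp 2 fun _ : Fin 2 => L2 L}
    (hh : h ∈ (solenoidalH1 L).topologicalClosure) :
    inner ℝ ((continuous_memLp (L := L) (continuous_const (y := a))).toLp _) h.1 = 0 := by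
  have hcl : IsClosed {h : L2 L × PiLp 2 fun _ : Fin 2 => L2 L |
      inner ℝ ((continuous_memLp (L := L) (continuous_const (y := a))).toLp _) h.1 = 0} :=
    isClosed_eq (continuous_const.inner continuous_fst) continuous_const
  have hsub : (solenoidalH1 L : Set _) ⊆ _ → _ := fun hs => closure_minimal hs hcl hh
  refine hsub fun q hq => ?_
  obtain ⟨u, hu, e, d⟩ := hq
  simp only [Set.mem_ofPred_eq]
  rw [inner_toLp continuous_const _ e,
    integral_inner (continuous_integrable (trigPoly_differentiable hu.1).continuous), hu.2.2,
    inner_zero_right]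

/-- The gradient is injective on `V`, so that `‖∇ u‖` is a norm. -/
theorem V.grad_injective (L : ℝ) (hL : 0 < L) : Function.Injective (V.grad L) := by
  rw [← LinearMap.ker_eq_bot, LinearMap.ker_eq_bot']
  rintro ⟨h, hh⟩ h0
  replace h0 : h.2 = 0 := h0
  have hpoly : ∀ u (hu : u ∈ trigPoly L),
      ∫ x in box L, inner ℝ (u x) ((h.1 : Plane → Vec) x) = 0 := by
    intro u hu
    suffices ∀ c : Continuous u, inner ℝ ((continuous_memLp (L := L) c).toLp _) h.1 = 0 by
      rw [← inner_toLp (trigPoly_differentiable hu).continuous h.1 (ae_eq_refl _)]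
      exact this (trigPoly_differentiable hu).continuous
    refine Submodule.span_induction (p := fun u _ => ∀ c : Continuous u,
      inner ℝ ((continuous_memLp (L := L) c).toLp _) h.1 = 0) ?_ ?_ ?_ ?_ hu
    · rintro f ⟨k, a, hf⟩ c
      by_cases hk : k = 0
      · subst hk
        rcases hf with rfl | rfl
        · have := average_closure a hh
          simpa [phase] using this
        · have := average_closure (0 : Vec) hh
          simpa [phase] using this
      · rcases hf with rfl | rfl
        · exact mode_parts_closure hL Real.contDiff_sin Real.hasDerivAt_sin
            Real.sin_add_int_mul_two_pi Real.continuous_cos k a c hk hh h0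
        · exact mode_parts_closure (m := fun t => - Real.cos t) hL Real.contDiff_cos.neg
            (fun t => by simpa using (Real.hasDerivAt_cos t).fun_neg)
            (fun t n => by rw [Real.cos_add_int_mul_two_pi]) Real.continuous_sin k a c hk hh h0
    · intro c
      rw [show (continuous_memLp (L := L) c).toLp (0 : Plane → Vec) = 0 from MemLp.toLp_zero _,
        inner_zero_left]
    · intro f g hf hg h1 h2 c
      have cf := (trigPoly_differentiable hf).continuous
      have cg := (trigPoly_differentiable hg).continuous
      rw [MemLp.toLp_add (continuous_memLp cf) (continuous_memLp cg), inner_add_left, h1 cf, h2 cg,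
        add_zero]
    · intro r f hf h1 c
      have cf := (trigPoly_differentiable hf).continuous
      rw [MemLp.toLp_const_smul r (continuous_memLp cf), inner_smul_left, h1 cf, mul_zero]
  have hself : inner ℝ h.1 h.1 = 0 := by
    have hcl : IsClosed {q : L2 L × PiLp 2 fun _ : Fin 2 => L2 L | inner ℝ q.1 h.1 = 0} :=
      isClosed_eq (continuous_fst.inner continuous_const) continuous_const
    have hsub : (solenoidalH1 L : Set _) ⊆ _ → _ := fun hs => closure_minimal hs hcl hh
    refine hsub fun q hq => ?_
    obtain ⟨u, hu, e, -⟩ := hq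
    simp only [Set.mem_ofPred_eq]
    rw [MeasureTheory.L2.inner_def, ← hpoly u hu.1]
    refine integral_congr_ae ?_
    filter_upwards [e] with x hx
    rw [hx]
  exact Subtype.ext (Prod.ext (inner_self_eq_zero.1 hself) h0)

/-- `V` carries the norm `‖u‖ = (∑ j, ‖∂_j u‖²)^(1/2)`, with `L²`-norms on the right. -/
instance (L : ℝ) [hL : Fact (0 < L)] : NormedAddCommGroup (V L) :=
  NormedAddCommGroup.induced (V L) (PiLp 2 fun _ : Fin 2 => L2 L) (V.grad L)
    (V.grad_injective L hL.out)

instance (L : ℝ) [Fact (0 < L)] : NormedSpace ℝ (V L) :=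
  NormedSpace.induced ℝ (V L) (PiLp 2 fun _ : Fin 2 => L2 L) (V.grad L)

/-! ## The operators of the Navier–Stokes equations

Elements of the dual space `V'` are given by their values at the elements of `V`. -/

/-- `⟨A u, φ⟩ = ∑ j, ∫ ∂_j u · ∂_j φ`. -/
def A {L : ℝ} (u : V L) : V L → ℝ := fun φ =>
  ∫ x in box L, ∑ j, inner ℝ (V.grad L u j x) (V.grad L φ j x)

/-- `⟨B(u, v), φ⟩ = ∫ ((u · ∇) v) · φ`. -/
def B {L : ℝ} (u v : V L) : V L → ℝ := fun φ =>
  ∫ x in box L, inner ℝ (∑ j, V.toL2 L u x j • V.grad L v j x) (V.toL2 L φ x)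

/-- `B_s(u, v) = B(u, v) + B(v, u)`. -/
def Bs {L : ℝ} (u v : V L) : V L → ℝ := B u v + B v u

/-- An element of `H` as an element of `V'`: `⟨g, φ⟩ = ∫ g · φ`. -/
def ofH {L : ℝ} (g : H L) : V L → ℝ := fun φ =>
  ∫ x in box L, inner ℝ ((g : L2 L) x) (V.toL2 L φ x)

/-- `u ∈ V` is a weak solution of the steady state equation `A u + α B(u, u) = g`. -/
def IsSteadyState {L : ℝ} (α : ℝ) (g : H L) (u : V L) : Prop :=
  A u + α • B u u = ofH g

end NSE

end

noncomputable section

namespace NSE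

open scoped ENNReal

/-! Write a steady state as `v + x`. Since `A v = g`, the deviation satisfies `A x + α (B(v,v) +
B_s(v,x) + B(x,x)) = 0`, and the theorem is obtained by matching orders in this identity, tested
against a fixed `φ`. With `x = Γ₁ r₁`, division by `α` gives `B(v,v) = 0`, and then division by `α
Γ₁` gives `B_s(v,w₁) = 0` (`B_base_eq_zero`, `Bs_first_eq_zero`). If `N = 1`, the remainder is
exactly `w₁`, so `Γ₁ A w₁ + α Γ₁² B(w₁,w₁) = 0`. Testing with `w₁` and using `⟨B(w₁,w₁),w₁⟩ = 0`
yields `w₁ = 0`, which a finite expansion forbids. With `x = Γ₁ w₁ + Γ₂ r₂`, the terms that can lead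
are `Γ₁ A w₁`, `α Γ₂ B_s(v,w₂)` and `α Γ₁² B(w₁,w₁)`; the others are of lower order because `Γ₁` and
`Γ₂/Γ₁` tend to zero. Dividing by the largest coefficient gives the equation of each scenario
(`second_order_balance`). In (i) the term with `B_s(v,w₂)` drops out and the `A` term survives, so
`w₁ = 0` by the same energy argument; only a degenerate expansion with all `w_k = 0` allows this.
Two analytic facts are needed: joint continuity of the trilinear form (`continuous_B`), which rests
on the embedding of `V` in `L⁴`, and `⟨B(u,u),u⟩ = 0` (`B_self`), which passes from trigonometric
polynomials to `V` by density. -/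

/-! ### Sobolev and Poincaré inequalities on a square. -/

theorem ennreal_add_sq_le (a b : ℝ≥0∞) : (a + b) ^ 2 ≤ 2 * (a ^ 2 + b ^ 2) := by
  by_cases ha : a = ∞
  · simp [ha]
  by_cases hb : b = ∞
  · simp [hb]
  lift a to NNReal using ha
  lift b to NNReal using hb
  have h : (a + b) ^ 2 ≤ 2 * (a ^ 2 + b ^ 2) := add_sq_le
  exact_mod_cast h

theorem lintegral_sq_le {X : Type*} [MeasurableSpace X] (μ : Measure X) {f : X → ℝ≥0∞}
    (hf : AEMeasurable f μ) : (∫⁻ x, f x ∂μ) ^ 2 ≤ μ Set.univ * ∫⁻ x, f x ^ 2 ∂μ := by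
  have h := ENNReal.lintegral_mul_le_Lp_mul_Lq μ Real.HolderConjugate.two_two hf
    (aemeasurable_const (b := (1 : ℝ≥0∞)))
  simp only [Pi.mul_apply, mul_one, lintegral_const, ENNReal.rpow_two, one_pow, one_mul] at h
  calc (∫⁻ x, f x ∂μ) ^ 2
      ≤ ((∫⁻ x, f x ^ 2 ∂μ) ^ (1 / 2 : ℝ) * μ Set.univ ^ (1 / 2 : ℝ)) ^ 2 := by gcongr
    _ = μ Set.univ * ∫⁻ x, f x ^ 2 ∂μ := by
      rw [mul_pow, ← ENNReal.rpow_natCast, ← ENNReal.rpow_natCast, ← ENNReal.rpow_mul,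
        ← ENNReal.rpow_mul]
      norm_num [mul_comm]

theorem lintegral_box (L : ℝ) {F : Plane → ℝ≥0∞} (hF : Measurable F) :
    ∫⁻ x in box L, F x = ∫⁻ t in Set.Icc 0 L, ∫⁻ s in Set.Icc 0 L, F ![t, s] := by
  have hm : Measurable fun p : ℝ × ℝ => F ![p.1, p.2] :=
    hF.comp (MeasurableEquiv.finTwoArrow (α := ℝ)).symm.measurable
  have hp := (volume_preserving_finTwoArrow ℝ).symm
  have hpre : (MeasurableEquiv.finTwoArrow (α := ℝ)).symm ⁻¹' box L
      = Set.Icc 0 L ×ˢ Set.Icc 0 L := by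
    ext p
    simp [box, Pi.le_def, Fin.forall_fin_two, Set.mem_Icc, Prod.le_def]
  rw [← (hp.restrict_preimage (s := box L) measurableSet_Icc).lintegral_comp hF, hpre,
    Measure.volume_eq_prod, ← Measure.prod_restrict, lintegral_prod _
      (by exact hm.aemeasurable)]
  rfl

theorem lintegral_box_symm (L : ℝ) {F : Plane → ℝ≥0∞} (hF : Measurable F) :
    ∫⁻ x in box L, F x = ∫⁻ s in Set.Icc 0 L, ∫⁻ t in Set.Icc 0 L, F ![t, s] := by
  rw [lintegral_box L hF, lintegral_lintegral_swap]
  exact (hF.comp (MeasurableEquiv.finTwoArrow (α := ℝ)).symm.measurable).aemeasurable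

theorem boxMeasure_univ (L : ℝ) : boxMeasure L Set.univ = ENNReal.ofReal L ^ 2 := by
  rw [Measure.restrict_apply_univ, box, Real.volume_Icc_pi]
  simp [sq]

section Line

variable {E : Type*} [NormedAddCommGroup E] [NormedSpace ℝ E]

/-- Fundamental theorem of calculus along a segment. The integral is enlarged to the whole side so
that the bound does not depend on the endpoints `t`, `t'`. -/
theorem enorm_sub_le_horizontal {L : ℝ} {u : Plane → E} (hu : ContDiff ℝ 1 u) {t t' : ℝ}
    (ht : t ∈ Set.Icc 0 L) (ht' : t' ∈ Set.Icc 0 L) (s : ℝ) :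
    ‖u ![t, s] - u ![t', s]‖ₑ
      ≤ ∫⁻ r in Set.Icc 0 L, ‖fderiv ℝ u ![r, s] (Pi.single 0 1)‖ₑ := by
  wlog h : t' ≤ t generalizing t t'
  · rw [← enorm_neg, neg_sub]
    exact this ht' ht (le_of_not_ge h)
  have hl (r : ℝ) : HasDerivAt (fun r : ℝ => (![r, s] : Plane)) (Pi.single 0 1) r := by
    rw [hasDerivAt_pi]
    intro i
    fin_cases i
    · simpa using hasDerivAt_id' r
    · simpa using hasDerivAt_const r s
  have hd (r : ℝ) : deriv (fun r => u ![r, s]) r = fderiv ℝ u ![r, s] (Pi.single 0 1) :=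
    (((hu.differentiable (by simp)) _).hasFDerivAt.comp_hasDerivAt r (hl r)).deriv
  have hc : ContDiff ℝ 1 fun r => u ![r, s] := by
    refine hu.comp (contDiff_pi.2 fun i => ?_)
    fin_cases i
    · simpa using contDiff_fun_id
    · simpa using contDiff_const
  refine (enorm_sub_le_lintegral_deriv_of_contDiffOn_Icc hc.contDiffOn h).trans ?_
  simp only [hd]
  exact lintegral_mono_set (Set.Icc_subset_Icc ht'.1 ht.2)

theorem enorm_sub_le_vertical {L : ℝ} {u : Plane → E} (hu : ContDiff ℝ 1 u) {s s' : ℝ}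
    (hs : s ∈ Set.Icc 0 L) (hs' : s' ∈ Set.Icc 0 L) (t : ℝ) :
    ‖u ![t, s] - u ![t, s']‖ₑ
      ≤ ∫⁻ r in Set.Icc 0 L, ‖fderiv ℝ u ![t, r] (Pi.single 1 1)‖ₑ := by
  wlog h : s' ≤ s generalizing s s'
  · rw [← enorm_neg, neg_sub]
    exact this hs' hs (le_of_not_ge h)
  have hl (r : ℝ) : HasDerivAt (fun r : ℝ => (![t, r] : Plane)) (Pi.single 1 1) r := by
    rw [hasDerivAt_pi]
    intro i
    fin_cases i
    · simpa using hasDerivAt_const r t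
    · simpa using hasDerivAt_id' r
  have hd (r : ℝ) : deriv (fun r => u ![t, r]) r = fderiv ℝ u ![t, r] (Pi.single 1 1) :=
    (((hu.differentiable (by simp)) _).hasFDerivAt.comp_hasDerivAt r (hl r)).deriv
  have hc : ContDiff ℝ 1 fun r => u ![t, r] := by
    refine hu.comp (contDiff_pi.2 fun i => ?_)
    fin_cases i
    · simpa using contDiff_const
    · simpa using contDiff_fun_id
  refine (enorm_sub_le_lintegral_deriv_of_contDiffOn_Icc hc.contDiffOn h).trans ?_
  simp only [hd]
  exact lintegral_mono_set (Set.Icc_subset_Icc hs'.1 hs.2)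

theorem measurable_enorm_fderiv {u : Plane → E} (hu : ContDiff ℝ 1 u) (e : Plane) :
    Measurable fun x => ‖fderiv ℝ u x e‖ₑ :=
  ((hu.continuous_fderiv (by simp)).clm_apply continuous_const).enorm.measurable

theorem measurable_horizontal {F : Plane → ℝ≥0∞} (hF : Measurable F) (s : ℝ) :
    Measurable fun t => F ![t, s] := by
  refine hF.comp (measurable_pi_iff.2 fun i => ?_)
  fin_cases i
  · simpa using measurable_id'
  · simp

theorem measurable_vertical {F : Plane → ℝ≥0∞} (hF : Measurable F) (t : ℝ) :
    Measurable fun s => F ![t, s] := by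
  refine hF.comp (measurable_pi_iff.2 fun i => ?_)
  fin_cases i
  · simp
  · simpa using measurable_id'

theorem measurable_lintegral_horizontal (L : ℝ) {F : Plane → ℝ≥0∞} (hF : Measurable F) :
    Measurable fun s => ∫⁻ t in Set.Icc 0 L, F ![t, s] :=
  Measurable.lintegral_prod_left'
    (f := fun p : ℝ × ℝ => F ![p.1, p.2])
    (hF.comp (MeasurableEquiv.finTwoArrow (α := ℝ)).symm.measurable)

theorem measurable_lintegral_vertical (L : ℝ) {F : Plane → ℝ≥0∞} (hF : Measurable F) :
    Measurable fun t => ∫⁻ s in Set.Icc 0 L, F ![t, s] :=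
  Measurable.lintegral_prod_right'
    (f := fun p : ℝ × ℝ => F ![p.1, p.2])
    (hF.comp (MeasurableEquiv.finTwoArrow (α := ℝ)).symm.measurable)

theorem lintegral_icc_const (L : ℝ) (c : ℝ≥0∞) :
    ∫⁻ _ in Set.Icc 0 L, c = ENNReal.ofReal L * c := by
  simp [mul_comm]

/-- Average over `r` the inequality `‖u(t,s)‖ ≤ ‖u(r,s)‖ + ‖u(t,s) - u(r,s)‖`. The resulting bound
is free of `t`, which is what `lintegral_sq_le_mul` exploits. -/
theorem enorm_le_horizontal {L : ℝ} {u : Plane → E} (hu : ContDiff ℝ 1 u) {t : ℝ}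
    (ht : t ∈ Set.Icc 0 L) (s : ℝ) :
    ENNReal.ofReal L * ‖u ![t, s]‖ₑ ≤ ∫⁻ r in Set.Icc 0 L,
      (‖u ![r, s]‖ₑ + ENNReal.ofReal L * ‖fderiv ℝ u ![r, s] (Pi.single 0 1)‖ₑ) := by
  have h1 := measurable_horizontal (measurable_enorm_fderiv hu (Pi.single 0 1)) s
  have h2 := measurable_horizontal hu.continuous.enorm.measurable s
  rw [lintegral_add_left h2, lintegral_const_mul _ h1, ← lintegral_icc_const,
    ← lintegral_icc_const, ← lintegral_add_left h2]
  refine setLIntegral_mono' measurableSet_Icc fun r hr => ?_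
  calc ‖u ![t, s]‖ₑ = ‖u ![r, s] + (u ![t, s] - u ![r, s])‖ₑ := by congr 1; abel
    _ ≤ _ := (enorm_add_le _ _).trans (add_le_add_right (enorm_sub_le_horizontal hu ht hr s) _)

theorem enorm_le_vertical {L : ℝ} {u : Plane → E} (hu : ContDiff ℝ 1 u) {s : ℝ}
    (hs : s ∈ Set.Icc 0 L) (t : ℝ) :
    ENNReal.ofReal L * ‖u ![t, s]‖ₑ ≤ ∫⁻ r in Set.Icc 0 L,
      (‖u ![t, r]‖ₑ + ENNReal.ofReal L * ‖fderiv ℝ u ![t, r] (Pi.single 1 1)‖ₑ) := by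
  have h1 := measurable_vertical (measurable_enorm_fderiv hu (Pi.single 1 1)) t
  have h2 := measurable_vertical hu.continuous.enorm.measurable t
  rw [lintegral_add_left h2, lintegral_const_mul _ h1, ← lintegral_icc_const,
    ← lintegral_icc_const, ← lintegral_add_left h2]
  refine setLIntegral_mono' measurableSet_Icc fun r hr => ?_
  calc ‖u ![t, s]‖ₑ = ‖u ![t, r] + (u ![t, s] - u ![t, r])‖ₑ := by congr 1; abel
    _ ≤ _ := (enorm_add_le _ _).trans (add_le_add_right (enorm_sub_le_vertical hu hs hr t) _)

/-- The embedding of `W^{1,1}` of a square in `L²`. -/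
theorem lintegral_sq_le_mul {L : ℝ} {u : Plane → E} (hu : ContDiff ℝ 1 u) :
    ENNReal.ofReal L ^ 2 * ∫⁻ x in box L, ‖u x‖ₑ ^ 2 ≤
      (∫⁻ x in box L, (‖u x‖ₑ + ENNReal.ofReal L * ‖fderiv ℝ u x (Pi.single 0 1)‖ₑ)) *
      ∫⁻ x in box L, (‖u x‖ₑ + ENNReal.ofReal L * ‖fderiv ℝ u x (Pi.single 1 1)‖ₑ) := by
  have mu := hu.continuous.enorm.measurable
  have m (e : Plane) : Measurable fun x => ‖u x‖ₑ + ENNReal.ofReal L * ‖fderiv ℝ u x e‖ₑ :=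
    mu.add ((measurable_enorm_fderiv hu e).const_mul _)
  rw [lintegral_box_symm L (m _), lintegral_box L (m (Pi.single 1 1)),
    lintegral_box L (mu.pow_const 2), ← lintegral_const_mul _
      (measurable_lintegral_vertical L (mu.pow_const 2)),
    ← lintegral_const_mul _ (measurable_lintegral_vertical L (m _))]
  refine setLIntegral_mono' measurableSet_Icc fun t ht => ?_
  rw [← lintegral_const_mul _ (measurable_vertical (mu.pow_const 2) t),
    ← lintegral_mul_const _ (measurable_lintegral_horizontal L (m _))]
  refine setLIntegral_mono' measurableSet_Icc fun s hs => ?_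
  -- One factor is bounded by a function of `s` alone, the other by a function of `t` alone, so the
  -- double integral of the product splits into a product of integrals.
  rw [← mul_pow, sq]
  exact mul_le_mul' (enorm_le_horizontal hu ht s) (enorm_le_vertical hu hs t)

/-- Go from `(t,s)` to `(t',s')` through the corner `(t',s)`, then apply Cauchy–Schwarz on each leg.
The bound depends only on `s` and `t'`. -/
theorem enorm_sub_sq_le {L : ℝ} {u : Plane → E} (hu : ContDiff ℝ 1 u) {t s t' s' : ℝ}
    (ht : t ∈ Set.Icc 0 L) (hs : s ∈ Set.Icc 0 L) (ht' : t' ∈ Set.Icc 0 L)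
    (hs' : s' ∈ Set.Icc 0 L) :
    ‖u ![t, s] - u ![t', s']‖ₑ ^ 2 ≤ 2 * ENNReal.ofReal L *
      ((∫⁻ r in Set.Icc 0 L, ‖fderiv ℝ u ![r, s] (Pi.single 0 1)‖ₑ ^ 2) +
        ∫⁻ r in Set.Icc 0 L, ‖fderiv ℝ u ![t', r] (Pi.single 1 1)‖ₑ ^ 2) := by
  have hL : volume.restrict (Set.Icc 0 L) Set.univ = ENNReal.ofReal L := by simp
  have h0 := lintegral_sq_le (volume.restrict (Set.Icc 0 L))
    (measurable_horizontal (measurable_enorm_fderiv hu (Pi.single 0 1)) s).aemeasurable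
  have h1 := lintegral_sq_le (volume.restrict (Set.Icc 0 L))
    (measurable_vertical (measurable_enorm_fderiv hu (Pi.single 1 1)) t').aemeasurable
  rw [hL] at h0 h1
  calc ‖u ![t, s] - u ![t', s']‖ₑ ^ 2
      = ‖(u ![t, s] - u ![t', s]) + (u ![t', s] - u ![t', s'])‖ₑ ^ 2 := by congr 2; abel
    _ ≤ (‖u ![t, s] - u ![t', s]‖ₑ + ‖u ![t', s] - u ![t', s']‖ₑ) ^ 2 := by
      gcongr; exact enorm_add_le _ _
    _ ≤ 2 * (‖u ![t, s] - u ![t', s]‖ₑ ^ 2 + ‖u ![t', s] - u ![t', s']‖ₑ ^ 2) :=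
      ennreal_add_sq_le _ _
    _ ≤ 2 * ((∫⁻ r in Set.Icc 0 L, ‖fderiv ℝ u ![r, s] (Pi.single 0 1)‖ₑ) ^ 2 +
        (∫⁻ r in Set.Icc 0 L, ‖fderiv ℝ u ![t', r] (Pi.single 1 1)‖ₑ) ^ 2) := by
      gcongr
      · exact enorm_sub_le_horizontal hu ht ht' s
      · exact enorm_sub_le_vertical hu hs hs' t'
    _ ≤ _ := by
      rw [mul_assoc, mul_add (ENNReal.ofReal L)]
      gcongr

/-- A function of zero mean satisfies `L² u(x) = ∫ (u(x) - u(y)) dy`. -/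
theorem volume_mul_enorm_le [CompleteSpace E] {L : ℝ} {u : Plane → E} (hu : Continuous u)
    (hmean : ∫ x in box L, u x = 0) (x : Plane) :
    ENNReal.ofReal L ^ 2 * ‖u x‖ₑ ≤ ∫⁻ y in box L, ‖u x - u y‖ₑ := by
  have hfin : IsFiniteMeasure (boxMeasure L) :=
    ⟨by rw [boxMeasure_univ]; finiteness⟩
  have h : ∫ y in box L, (u x - u y) = (boxMeasure L).real Set.univ • u x := by
    rw [integral_sub (integrable_const _) (continuous_integrable hu), hmean, sub_zero,
      integral_const]
  calc ENNReal.ofReal L ^ 2 * ‖u x‖ₑ = ‖∫ y in box L, (u x - u y)‖ₑ := by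
        rw [h, enorm_smul, ← boxMeasure_univ, Measure.real, Real.enorm_of_nonneg (by positivity),
          ENNReal.ofReal_toReal (measure_ne_top _ _)]
    _ ≤ _ := enorm_integral_le_lintegral_enorm _

/-- Poincaré's inequality on a square. -/
theorem poincare [CompleteSpace E] {L : ℝ} (hL : 0 < L) {u : Plane → E} (hu : ContDiff ℝ 1 u)
    (hmean : ∫ x in box L, u x = 0) :
    ∫⁻ x in box L, ‖u x‖ₑ ^ 2 ≤ 2 * ENNReal.ofReal L ^ 2 *
      ((∫⁻ x in box L, ‖fderiv ℝ u x (Pi.single 0 1)‖ₑ ^ 2) +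
        ∫⁻ x in box L, ‖fderiv ℝ u x (Pi.single 1 1)‖ₑ ^ 2) := by
  set M := ENNReal.ofReal L with hM
  have M0 : M ≠ 0 := by simpa [hM] using hL
  have Mt : M ≠ ∞ := by simp [hM]
  have mu := hu.continuous.enorm.measurable.pow_const 2
  have m (e : Plane) : Measurable fun x => ‖fderiv ℝ u x e‖ₑ ^ 2 :=
    (measurable_enorm_fderiv hu e).pow_const 2
  set D := ∫⁻ x in box L, ‖fderiv ℝ u x (Pi.single 1 1)‖ₑ ^ 2 with hD
  -- Square the mean-value bound and integrate `enorm_sub_sq_le` over the second point `(t',s')`: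
  -- the vertical leg becomes the full integral `D`, while the horizontal leg stays on the line at
  -- height `s` and is integrated only in `key`.
  have hpt : ∀ t ∈ Set.Icc 0 L, ∀ s ∈ Set.Icc 0 L, (M ^ 2 * ‖u ![t, s]‖ₑ) ^ 2 ≤
      2 * M ^ 4 * (M * (∫⁻ r in Set.Icc 0 L, ‖fderiv ℝ u ![r, s] (Pi.single 0 1)‖ₑ ^ 2) + D) := by
    intro t ht s hs
    have hms : Measurable fun y => ‖u ![t, s] - u y‖ₑ :=
      (continuous_const.sub hu.continuous).enorm.measurable
    calc (M ^ 2 * ‖u ![t, s]‖ₑ) ^ 2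
        ≤ (∫⁻ y in box L, ‖u ![t, s] - u y‖ₑ) ^ 2 := by
          gcongr; exact volume_mul_enorm_le hu.continuous hmean _
      _ ≤ M ^ 2 * ∫⁻ y in box L, ‖u ![t, s] - u y‖ₑ ^ 2 := by
          rw [← boxMeasure_univ]; exact lintegral_sq_le _ hms.aemeasurable
      _ ≤ M ^ 2 * ∫⁻ t' in Set.Icc 0 L, ∫⁻ _ in Set.Icc 0 L, 2 * M *
          ((∫⁻ r in Set.Icc 0 L, ‖fderiv ℝ u ![r, s] (Pi.single 0 1)‖ₑ ^ 2) +
            ∫⁻ r in Set.Icc 0 L, ‖fderiv ℝ u ![t', r] (Pi.single 1 1)‖ₑ ^ 2) := by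
          rw [lintegral_box L (hms.pow_const 2)]
          refine mul_le_mul_right ?_ _
          refine setLIntegral_mono' measurableSet_Icc fun t' ht' => ?_
          refine setLIntegral_mono' measurableSet_Icc fun s' hs' => ?_
          exact enorm_sub_sq_le hu ht hs ht' hs'
      _ = _ := by
          simp only [lintegral_icc_const]
          rw [lintegral_const_mul' _ _ ENNReal.ofReal_ne_top,
            lintegral_const_mul' _ _ (by finiteness),
            lintegral_add_left measurable_const, lintegral_icc_const, hD, lintegral_box L (m _),
            ← hM]
          ring
  have key : M ^ 4 * ∫⁻ x in box L, ‖u x‖ₑ ^ 2 ≤ M ^ 4 * (2 * M ^ 2 *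
      ((∫⁻ x in box L, ‖fderiv ℝ u x (Pi.single 0 1)‖ₑ ^ 2) + D)) := by
    calc M ^ 4 * ∫⁻ x in box L, ‖u x‖ₑ ^ 2
        = ∫⁻ t in Set.Icc 0 L, ∫⁻ s in Set.Icc 0 L, (M ^ 2 * ‖u ![t, s]‖ₑ) ^ 2 := by
          rw [← lintegral_const_mul _ mu, lintegral_box L (mu.const_mul _)]
          simp only [mul_pow, ← pow_mul]
      _ ≤ ∫⁻ _ in Set.Icc 0 L, ∫⁻ s in Set.Icc 0 L, 2 * M ^ 4 *
          (M * (∫⁻ r in Set.Icc 0 L, ‖fderiv ℝ u ![r, s] (Pi.single 0 1)‖ₑ ^ 2) + D) :=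
          setLIntegral_mono' measurableSet_Icc fun t ht =>
            setLIntegral_mono' measurableSet_Icc fun s hs => hpt t ht s hs
      _ = _ := by
          have mh := measurable_lintegral_horizontal L (m (Pi.single 0 1))
          rw [lintegral_icc_const, lintegral_const_mul' _ _ (by finiteness),
            lintegral_add_right _ measurable_const, lintegral_icc_const,
            lintegral_const_mul _ mh, lintegral_box_symm L (m _), ← hM]
          ring
  exact (ENNReal.mul_le_mul_iff_right (by positivity) (by finiteness)).1 key

end Line

/-- The embedding of `H¹` of a square in `L⁴`. -/
theorem lintegral_enorm_pow_four_le {L : ℝ} (hL : 0 < L) {u : Plane → Vec} (hu : ContDiff ℝ 1 u)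
    (hmean : ∫ x in box L, u x = 0) :
    ENNReal.ofReal L ^ 2 * ∫⁻ x in box L, ‖u x‖ₑ ^ 4 ≤
      ((1 + ENNReal.ofReal L) * (2 * ENNReal.ofReal L ^ 2 + 1) *
      ((∫⁻ x in box L, ‖pderiv 0 u x‖ₑ ^ 2) + ∫⁻ x in box L, ‖pderiv 1 u x‖ₑ ^ 2)) ^ 2 := by
  set D := (∫⁻ x in box L, ‖pderiv 0 u x‖ₑ ^ 2) + ∫⁻ x in box L, ‖pderiv 1 u x‖ₑ ^ 2 with hD
  have hP : ∫⁻ x in box L, ‖u x‖ₑ ^ 2 ≤ 2 * ENNReal.ofReal L ^ 2 * D := poincare hL hu hmean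
  have mu := hu.continuous.enorm.measurable.pow_const 2
  have m (j : Fin 2) : Measurable fun x => ‖pderiv j u x‖ₑ ^ 2 :=
    (measurable_enorm_fderiv hu _).pow_const 2
  -- The `W^{1,1}` embedding is applied to `‖u‖²`: its `L²` norm is the square of the `L⁴` norm of
  -- `u`, and its gradient is controlled by `2‖u‖‖∂_j u‖ ≤ ‖u‖² + ‖∂_j u‖²`.
  have hn : ContDiff ℝ 1 fun x => (‖u x‖ ^ 2 : ℝ) := hu.norm_sq ℝ
  have he (x : Plane) : ‖(‖u x‖ ^ 2 : ℝ)‖ₑ = ‖u x‖ₑ ^ 2 := by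
    rw [enorm_pow, enorm_norm]
  have hd (j : Fin 2) (x : Plane) : ‖fderiv ℝ (fun x => (‖u x‖ ^ 2 : ℝ)) x (Pi.single j 1)‖ₑ
      ≤ ‖u x‖ₑ ^ 2 + ‖pderiv j u x‖ₑ ^ 2 := by
    have h1 := ((hu.differentiable (by simp)) x).hasFDerivAt.norm_sq
    have h2 : fderiv ℝ (fun x => (‖u x‖ ^ 2 : ℝ)) x (Pi.single j 1)
        = 2 * inner ℝ (u x) (pderiv j u x) := by
      rw [h1.fderiv]; simp [pderiv]
    rw [h2, ← enorm_norm (u x), ← enorm_norm (pderiv j u x), ← enorm_pow, ← enorm_pow,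
      Real.enorm_of_nonneg (r := ‖u x‖ ^ 2) (by positivity),
      Real.enorm_of_nonneg (r := ‖pderiv j u x‖ ^ 2) (by positivity),
      ← ENNReal.ofReal_add (by positivity) (by positivity), Real.enorm_eq_ofReal_abs]
    refine ENNReal.ofReal_le_ofReal ?_
    rw [abs_mul, abs_two]
    have := abs_real_inner_le_norm (u x) (pderiv j u x)
    nlinarith [sq_nonneg (‖u x‖ - ‖pderiv j u x‖)]
  have hI (j : Fin 2) : ∫⁻ x in box L, (‖(‖u x‖ ^ 2 : ℝ)‖ₑ + ENNReal.ofReal L *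
      ‖fderiv ℝ (fun x => (‖u x‖ ^ 2 : ℝ)) x (Pi.single j 1)‖ₑ) ≤
      (1 + ENNReal.ofReal L) * (2 * ENNReal.ofReal L ^ 2 + 1) * D := by
    have hj : ∫⁻ x in box L, ‖pderiv j u x‖ₑ ^ 2 ≤ D := by
      fin_cases j
      · exact le_self_add
      · exact le_add_self
    calc _ ≤ ∫⁻ x in box L, (1 + ENNReal.ofReal L) * (‖u x‖ₑ ^ 2 + ‖pderiv j u x‖ₑ ^ 2) := by
          refine lintegral_mono fun x => ?_
          rw [he, add_mul, one_mul]
          gcongr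
          · exact le_self_add
          · exact hd j x
      _ = (1 + ENNReal.ofReal L) *
          ((∫⁻ x in box L, ‖u x‖ₑ ^ 2) + ∫⁻ x in box L, ‖pderiv j u x‖ₑ ^ 2) := by
          rw [lintegral_const_mul' _ _ (by finiteness), lintegral_add_left mu]
      _ ≤ (1 + ENNReal.ofReal L) * (2 * ENNReal.ofReal L ^ 2 * D + D) := by gcongr
      _ = _ := by ring
  have key := lintegral_sq_le_mul (L := L) hn
  simp only [he, ← pow_mul] at key
  refine key.trans ?_
  rw [sq]
  simp only [he] at hI
  exact mul_le_mul' (hI 0) (hI 1)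

/-! ### The forms `A` and `B` on `V`: continuity, linearity and cancellation. -/

variable {L : ℝ}

/-- The elements of `V` that are trigonometric polynomials. -/
def IsTrig (q : V L) (p : Plane → Vec) : Prop :=
  p ∈ solenoidal L ∧ V.toL2 L q =ᵐ[boxMeasure L] p ∧
    ∀ j, V.grad L q j =ᵐ[boxMeasure L] pderiv j p

theorem IsTrig.contDiff {q : V L} {p : Plane → Vec} (h : IsTrig q p) : ContDiff ℝ 1 p :=
  (trigPoly_contDiff h.1.1).of_le le_top

theorem holderTriple_four_four_two : ENNReal.HolderTriple 4 4 2 where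
  inv_add_inv_eq_inv := by
    rw [← two_mul, show (4 : ℝ≥0∞) = 2 * 2 by norm_num,
      ENNReal.mul_inv (by simp) (by simp), ← mul_assoc,
      ENNReal.mul_inv_cancel (by simp) (by simp), one_mul]

theorem eLpNorm_coord_smul_le (j : Fin 2) (u φ : V L) :
    eLpNorm (fun x => V.toL2 L u x j • V.toL2 L φ x) 2 (boxMeasure L) ≤
      eLpNorm (V.toL2 L u) 4 (boxMeasure L) * eLpNorm (V.toL2 L φ) 4 (boxMeasure L) := by
  have := holderTriple_four_four_two
  have h := eLpNorm_le_eLpNorm_mul_eLpNorm'_of_norm (p := 4) (q := 4) (r := 2)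
    (Lp.aestronglyMeasurable (V.toL2 L u)) (Lp.aestronglyMeasurable (V.toL2 L φ))
    (fun a b : Vec => a j • b) 1 (Eventually.of_forall fun x => by
      rw [norm_smul, NNReal.coe_one, one_mul]
      gcongr
      exact PiLp.norm_apply_le _ j)
  simpa using h

theorem aestronglyMeasurable_coord_smul (j : Fin 2) (f g : L2 L) :
    AEStronglyMeasurable (fun x => f x j • g x) (boxMeasure L) :=
  ((PiLp.continuous_apply 2 _ j).comp_aestronglyMeasurable (Lp.aestronglyMeasurable f)).smul
    (Lp.aestronglyMeasurable g)

theorem A_eq_inner (u φ : V L) : A u φ = inner ℝ (V.grad L u) (V.grad L φ) := by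
  rw [PiLp.inner_apply]
  simp only [MeasureTheory.L2.inner_def]
  rw [← integral_finsetSum _ fun j _ => MeasureTheory.L2.integrable_inner _ _]
  rfl

theorem L2.enorm_sq_eq (f : L2 L) {p : Plane → Vec} (h : f =ᵐ[boxMeasure L] p) :
    ‖f‖ₑ ^ 2 = ∫⁻ x in box L, ‖p x‖ₑ ^ 2 := by
  have := eLpNorm_nnreal_pow_eq_lintegral (f := p) (μ := boxMeasure L) (p := 2) (by simp)
  rw [Lp.enorm_def, eLpNorm_congr_ae h]
  simpa using this

theorem A_add (u u' : V L) : A (u + u') = A u + A u' := by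
  funext φ
  simp only [Pi.add_apply, A_eq_inner, map_add, inner_add_left]

theorem A_smul (c : ℝ) (u : V L) : A (c • u) = c • A u := by
  funext φ
  simp only [Pi.smul_apply, A_eq_inner, map_smul, real_inner_smul_left, smul_eq_mul]

variable [hL : Fact (0 < L)]

theorem V.norm_eq (u : V L) : ‖u‖ = ‖V.grad L u‖ := rfl

theorem V.norm_sq_eq (u : V L) : ‖u‖ ^ 2 = ‖V.grad L u 0‖ ^ 2 + ‖V.grad L u 1‖ ^ 2 := by
  rw [V.norm_eq, PiLp.norm_sq_eq_of_L2, Fin.sum_univ_two]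

theorem V.continuous_grad : Continuous (V.grad L) :=
  AddMonoidHomClass.continuous_of_bound (V.grad L) 1 fun u => by rw [one_mul, V.norm_eq]

theorem V.continuous_grad_apply (j : Fin 2) : Continuous fun u : V L => V.grad L u j :=
  (PiLp.continuous_apply 2 _ j).comp V.continuous_grad

/-- The norm of `V` sees only the gradient, so convergence in `L²` is recorded separately; both come
from convergence in the ambient product space. -/
theorem V.exists_trig_seq (u : V L) : ∃ (q : ℕ → V L) (p : ℕ → Plane → Vec),
    (∀ n, IsTrig (q n) (p n)) ∧ Tendsto (fun n => V.toL2 L (q n)) atTop (𝓝 (V.toL2 L u)) ∧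
      Tendsto q atTop (𝓝 u) := by
  obtain ⟨h, hh⟩ := u
  obtain ⟨x, hx, hlim⟩ := mem_closure_iff_seq_limit.1 hh
  choose p hp he hd using hx
  let q : ℕ → V L := fun n =>
    ⟨x n, (solenoidalH1 L).le_topologicalClosure ⟨p n, hp n, he n, hd n⟩⟩
  refine ⟨q, p, fun n => ⟨hp n, he n, hd n⟩, (continuous_fst.tendsto _).comp hlim, ?_⟩
  refine tendsto_iff_norm_sub_tendsto_zero.2 ?_
  have h2 : Tendsto (fun n => (x n).2) atTop (𝓝 h.2) := (continuous_snd.tendsto _).comp hlim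
  have h3 : Tendsto (fun n => ‖(x n).2 - h.2‖) atTop (𝓝 0) :=
    tendsto_iff_norm_sub_tendsto_zero.1 h2
  exact h3

theorem V.enorm_sq_eq (u : V L) : ‖u‖ₑ ^ 2 = ‖V.grad L u 0‖ₑ ^ 2 + ‖V.grad L u 1‖ₑ ^ 2 := by
  simp only [← ofReal_norm, ← ENNReal.ofReal_pow (norm_nonneg _)]
  rw [V.norm_sq_eq, ENNReal.ofReal_add (by positivity) (by positivity)]

theorem IsTrig.enorm_sq_eq {q : V L} {p : Plane → Vec} (h : IsTrig q p) :
    ‖q‖ₑ ^ 2 = (∫⁻ x in box L, ‖pderiv 0 p x‖ₑ ^ 2) + ∫⁻ x in box L, ‖pderiv 1 p x‖ₑ ^ 2 := by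
  rw [V.enorm_sq_eq, L2.enorm_sq_eq _ (h.2.2 0), L2.enorm_sq_eq _ (h.2.2 1)]

theorem IsTrig.eLpNorm_four_le {q : V L} {p : Plane → Vec} (h : IsTrig q p) :
    eLpNorm (V.toL2 L q) 4 (boxMeasure L) ^ 4 ≤
      (((1 + ENNReal.ofReal L) * (2 * ENNReal.ofReal L ^ 2 + 1)) ^ 2 / ENNReal.ofReal L ^ 2) *
        ‖q‖ₑ ^ 4 := by
  have h4 := eLpNorm_nnreal_pow_eq_lintegral (f := p) (μ := boxMeasure L) (p := 4) (by simp)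
  have h4' : eLpNorm (V.toL2 L q) 4 (boxMeasure L) ^ 4 = ∫⁻ x in box L, ‖p x‖ₑ ^ 4 := by
    rw [eLpNorm_congr_ae h.2.1]
    have e (x : ℝ≥0∞) : x ^ (4 : ℝ) = x ^ 4 := by exact_mod_cast ENNReal.rpow_natCast x 4
    simpa [e] using h4
  have M0 : ENNReal.ofReal L ≠ 0 := by simpa using hL.out
  have key := lintegral_enorm_pow_four_le hL.out h.contDiff h.1.2.2
  rw [← h.enorm_sq_eq, mul_pow, ← pow_mul, mul_comm] at key
  rw [h4', ENNReal.mul_div_right_comm.symm,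
    ENNReal.le_div_iff_mul_le (Or.inl (by positivity)) (Or.inl (by finiteness))]
  exact key

/-- The embedding of `V` in `L⁴`. -/
theorem V.exists_eLpNorm_four_le (L : ℝ) [hL : Fact (0 < L)] : ∃ C : NNReal, ∀ u : V L,
    eLpNorm (V.toL2 L u) 4 (boxMeasure L) ≤ C * ‖u‖ₑ := by
  set K := ((1 + ENNReal.ofReal L) * (2 * ENNReal.ofReal L ^ 2 + 1)) ^ 2 / ENNReal.ofReal L ^ 2
    with hK
  have M0 : ENNReal.ofReal L ≠ 0 := by simpa using hL.out
  have hKt : K ≠ ∞ := ENNReal.div_ne_top (by finiteness) (by positivity)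
  have hCt : K ^ (1 / 4 : ℝ) ≠ ∞ := by finiteness
  refine ⟨(K ^ (1 / 4 : ℝ)).toNNReal, fun u => ?_⟩
  rw [ENNReal.coe_toNNReal hCt]
  obtain ⟨q, p, ht, h2, hV⟩ := V.exists_trig_seq u
  -- Convergence in `L²` gives an almost everywhere convergent subsequence, along which Fatou's
  -- lemma carries the `L⁴` bound to the limit.
  obtain ⟨ns, hns, hae⟩ := (tendstoInMeasure_of_tendsto_Lp h2).exists_seq_tendsto_ae
  refine (Lp.eLpNorm_lim_le_liminf_eLpNorm (p := 4)
    (fun n => Lp.aestronglyMeasurable (V.toL2 L (q (ns n)))) _ hae).trans ?_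
  have hb (n : ℕ) : eLpNorm (V.toL2 L (q n)) 4 (boxMeasure L) ≤ K ^ (1 / 4 : ℝ) * ‖q n‖ₑ := by
    rw [← ENNReal.pow_le_pow_left_iff (n := 4) (by simp), mul_pow, ← ENNReal.rpow_natCast (K ^ _),
      ← ENNReal.rpow_mul]
    norm_num
    exact (ht n).eLpNorm_four_le
  have hlim : Tendsto (fun n => K ^ (1 / 4 : ℝ) * ‖q (ns n)‖ₑ) atTop
      (𝓝 (K ^ (1 / 4 : ℝ) * ‖u‖ₑ)) :=
    ENNReal.Tendsto.const_mul ((continuous_enorm.tendsto u).comp (hV.comp hns.tendsto_atTop))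
      (Or.inr hCt)
  rw [← hlim.liminf_eq]
  exact liminf_le_liminf (Eventually.of_forall fun n => hb _)

theorem memLp_coord_smul (j : Fin 2) (u φ : V L) :
    MemLp (fun x => V.toL2 L u x j • V.toL2 L φ x) 2 (boxMeasure L) := by
  obtain ⟨C, hC⟩ := V.exists_eLpNorm_four_le L
  refine ⟨aestronglyMeasurable_coord_smul j _ _, (eLpNorm_coord_smul_le j u φ).trans_lt ?_⟩
  exact ENNReal.mul_lt_top ((hC u).trans_lt (by finiteness)) ((hC φ).trans_lt (by finiteness))

/-- The product `u_j φ` of a component of `u ∈ V` and of `φ ∈ V`, as an element of `L²`. -/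
def coordSMul (j : Fin 2) (u φ : V L) : L2 L := (memLp_coord_smul j u φ).toLp _

theorem coordSMul_coeFn (j : Fin 2) (u φ : V L) :
    coordSMul j u φ =ᵐ[boxMeasure L] fun x => V.toL2 L u x j • V.toL2 L φ x :=
  (memLp_coord_smul j u φ).coeFn_toLp

theorem coordSMul_add_left (j : Fin 2) (u u' φ : V L) :
    coordSMul j (u + u') φ = coordSMul j u φ + coordSMul j u' φ := by
  unfold coordSMul
  rw [← MemLp.toLp_add]
  refine MemLp.toLp_congr _ _ ?_
  rw [map_add]
  filter_upwards [Lp.coeFn_add (V.toL2 L u) (V.toL2 L u')] with x hx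
  simp only [hx, Pi.add_apply, PiLp.add_apply, add_smul]

theorem coordSMul_smul_left (j : Fin 2) (c : ℝ) (u φ : V L) :
    coordSMul j (c • u) φ = c • coordSMul j u φ := by
  unfold coordSMul
  rw [← MemLp.toLp_const_smul]
  refine MemLp.toLp_congr _ _ ?_
  rw [map_smul]
  filter_upwards [Lp.coeFn_smul c (V.toL2 L u)] with x hx
  simp only [hx, Pi.smul_apply, PiLp.smul_apply, smul_assoc]

theorem coordSMul_add_right (j : Fin 2) (u φ φ' : V L) :
    coordSMul j u (φ + φ') = coordSMul j u φ + coordSMul j u φ' := by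
  unfold coordSMul
  rw [← MemLp.toLp_add]
  refine MemLp.toLp_congr _ _ ?_
  rw [map_add]
  filter_upwards [Lp.coeFn_add (V.toL2 L φ) (V.toL2 L φ')] with x hx
  simp only [hx, Pi.add_apply, smul_add]

theorem coordSMul_smul_right (j : Fin 2) (c : ℝ) (u φ : V L) :
    coordSMul j u (c • φ) = c • coordSMul j u φ := by
  unfold coordSMul
  rw [← MemLp.toLp_const_smul]
  refine MemLp.toLp_congr _ _ ?_
  rw [map_smul]
  filter_upwards [Lp.coeFn_smul c (V.toL2 L φ)] with x hx
  simp only [hx, Pi.smul_apply, smul_comm c]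

theorem exists_norm_coordSMul_le (L : ℝ) [hL : Fact (0 < L)] (j : Fin 2) :
    ∃ C : NNReal, ∀ u φ : V L, ‖coordSMul j u φ‖ ≤ C * ‖u‖ * ‖φ‖ := by
  obtain ⟨C, hC⟩ := V.exists_eLpNorm_four_le L
  refine ⟨C * C, fun u φ => ?_⟩
  have h : ‖coordSMul j u φ‖ₑ ≤ (C * ‖u‖ₑ) * (C * ‖φ‖ₑ) := by
    rw [Lp.enorm_def, eLpNorm_congr_ae (coordSMul_coeFn j u φ)]
    exact (eLpNorm_coord_smul_le j u φ).trans (mul_le_mul' (hC u) (hC φ))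
  simp only [enorm_eq_nnnorm] at h
  have h' : ‖coordSMul j u φ‖₊ ≤ (C * ‖u‖₊) * (C * ‖φ‖₊) := by exact_mod_cast h
  calc ‖coordSMul j u φ‖ ≤ (C * ‖u‖) * (C * ‖φ‖) := by exact_mod_cast h'
    _ = _ := by push_cast; ring

theorem continuous_coordSMul (j : Fin 2) :
    Continuous fun p : V L × V L => coordSMul j p.1 p.2 := by
  obtain ⟨C, hC⟩ := exists_norm_coordSMul_le L j
  have hb : IsBoundedBilinearMap ℝ fun p : V L × V L => coordSMul j p.1 p.2 :=
    { add_left := coordSMul_add_left j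
      smul_left := coordSMul_smul_left j
      add_right := coordSMul_add_right j
      smul_right := fun c u φ => coordSMul_smul_right j c u φ
      -- A bounded bilinear map asks for a strictly positive constant, and `C` might be zero.
      bound := ⟨C + 1, by positivity, fun u φ => (hC u φ).trans (by gcongr; simp)⟩ }
  exact hb.continuous

/-- Moving the scalar `u_j` from `∂_j v` onto `φ` turns the form into `L²` inner products. Linearity
and continuity are then inherited, with no separate integrability checks. -/
theorem B_eq_sum (u v φ : V L) :
    B u v φ = ∑ j, inner ℝ (V.grad L v j) (coordSMul j u φ) := by
  have hint (j : Fin 2) : Integrable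
      (fun x => inner ℝ (V.grad L v j x) (coordSMul j u φ x)) (boxMeasure L) :=
    MeasureTheory.L2.integrable_inner _ _
  simp only [MeasureTheory.L2.inner_def]
  rw [← integral_finsetSum _ fun j _ => hint j]
  refine integral_congr_ae ?_
  filter_upwards [coordSMul_coeFn 0 u φ, coordSMul_coeFn 1 u φ] with x e0 e1
  simp only [Fin.sum_univ_two, e0, e1, inner_add_left, real_inner_smul_left,
    real_inner_smul_right]

theorem continuous_B : Continuous fun p : V L × V L × V L => B p.1 p.2.1 p.2.2 := by
  simp only [B_eq_sum]
  refine continuous_finsetSum _ fun j _ => ?_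
  refine ((V.continuous_grad_apply j).comp (continuous_fst.comp continuous_snd)).inner ?_
  exact (continuous_coordSMul j).comp
    (continuous_fst.prodMk (continuous_snd.comp continuous_snd))

theorem B_add_left (u u' v : V L) : B (u + u') v = B u v + B u' v := by
  funext φ
  simp only [Pi.add_apply, B_eq_sum, coordSMul_add_left, inner_add_right,
    Finset.sum_add_distrib]

theorem B_smul_left (c : ℝ) (u v : V L) : B (c • u) v = c • B u v := by
  funext φ
  simp only [Pi.smul_apply, B_eq_sum, coordSMul_smul_left,
    real_inner_smul_right, smul_eq_mul, Finset.mul_sum]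

theorem B_add_right (u v v' : V L) : B u (v + v') = B u v + B u v' := by
  funext φ
  simp only [Pi.add_apply, B_eq_sum, map_add, PiLp.add_apply, inner_add_left,
    Finset.sum_add_distrib]

theorem B_smul_right (c : ℝ) (u v : V L) : B u (c • v) = c • B u v := by
  funext φ
  simp only [Pi.smul_apply, B_eq_sum, map_smul, PiLp.smul_apply,
    real_inner_smul_left, smul_eq_mul, Finset.mul_sum]

theorem continuous_A (φ : V L) : Continuous fun u : V L => A u φ := by
  simp only [A_eq_inner]
  exact V.continuous_grad.inner continuous_const

theorem A_self (u : V L) : A u u = ‖u‖ ^ 2 := by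
  rw [A_eq_inner, real_inner_self_eq_norm_sq, V.norm_eq]

/-- The divergence of `‖p‖² p` is `(div p) ‖p‖² + 2 ((p·∇)p)·p`. Its first term vanishes, and
periodicity makes the integral of the whole vanish. -/
theorem integral_advection_self {p : Plane → Vec} (hp : p ∈ solenoidal L) :
    ∫ x in box L, inner ℝ (∑ j, p x j • pderiv j p x) (p x) = 0 := by
  have hc : ContDiff ℝ 1 p := (trigPoly_contDiff hp.1).of_le le_top
  have hF (j : Fin 2) : ContDiff ℝ 1 fun x => p x j * ‖p x‖ ^ 2 :=
    ((contDiff_euclidean.1 hc) j).mul (hc.norm_sq ℝ)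
  have hper (j : Fin 2) := integral_fderiv_periodic hL.out (hF j) j
    (fun x => by rw [trigPoly_periodic hL.out hp.1])
  have hd (j : Fin 2) (x : Plane) : fderiv ℝ (fun x => p x j * ‖p x‖ ^ 2) x (Pi.single j 1)
      = pderiv j p x j * ‖p x‖ ^ 2 + 2 * inner ℝ (p x j • pderiv j p x) (p x) := by
    have hp' := ((hc.differentiable (by simp)) x).hasFDerivAt
    have h1 : HasFDerivAt (fun x => p x j)
        ((EuclideanSpace.proj (𝕜 := ℝ) j).comp (fderiv ℝ p x)) x :=
      (EuclideanSpace.proj (𝕜 := ℝ) j).hasFDerivAt.comp x hp'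
    rw [(h1.fun_mul hp'.norm_sq).fderiv]
    rw [real_inner_smul_left, real_inner_comm (p x)]
    simp [pderiv]
    ring
  have hi (j : Fin 2) : Integrable
      (fun x => fderiv ℝ (fun x => p x j * ‖p x‖ ^ 2) x (Pi.single j 1)) (boxMeasure L) :=
    continuous_integrable (((hF j).continuous_fderiv (by simp)).clm_apply continuous_const)
  have hsum (x : Plane) : inner ℝ (∑ j, p x j • pderiv j p x) (p x) =
      (1 / 2) * ∑ j, fderiv ℝ (fun x => p x j * ‖p x‖ ^ 2) x (Pi.single j 1) := by
    simp only [hd, Finset.sum_add_distrib, ← Finset.sum_mul, hp.2.1 x, ← Finset.mul_sum, sum_inner]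
    ring
  simp only [hsum]
  rw [integral_const_mul, integral_finsetSum _ fun j _ => hi j]
  simp [hper]

theorem IsTrig.B_self {q : V L} {p : Plane → Vec} (h : IsTrig q p) : B q q q = 0 := by
  rw [← integral_advection_self h.1]
  refine integral_congr_ae ?_
  filter_upwards [h.2.1, h.2.2 0, h.2.2 1] with x h0 h1 h2
  simp only [Fin.sum_univ_two, h0, h1, h2]

theorem B_self (u : V L) : B u u u = 0 := by
  obtain ⟨q, p, ht, -, hV⟩ := V.exists_trig_seq u
  have h := (continuous_B.tendsto (u, u, u)).comp (hV.prodMk_nhds (hV.prodMk_nhds hV))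
  refine tendsto_nhds_unique h ?_
  simp only [Function.comp_def, (ht _).B_self]
  exact tendsto_const_nhds

end NSE

/-! ### Comparison of positive sequences. -/

section Comparison

variable {ξ η ζ : ℕ → ℝ}

theorem SeqDominates.tendsto_inv (h : SeqDominates ξ η) :
    Tendsto (fun n => η n / ξ n) atTop (𝓝 0) := by
  simpa [Pi.inv_def] using! h.inv_tendsto_atTop

theorem SeqEquiv.symm (h : SeqEquiv ξ η) : SeqEquiv η ξ := by
  obtain ⟨c, hc, h⟩ := h
  exact ⟨c⁻¹, inv_pos.2 hc, by simpa using h.inv₀ hc.ne'⟩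

theorem SeqEquiv.trans (hη : ∀ n, 0 < η n) (h : SeqEquiv ξ η) (h' : SeqEquiv η ζ) :
    SeqEquiv ξ ζ := by
  obtain ⟨c, hc, h⟩ := h
  obtain ⟨c', hc', h'⟩ := h'
  exact ⟨c * c', mul_pos hc hc', (h.mul h').congr fun n => div_mul_div_cancel₀ (hη n).ne'⟩

theorem SeqDominates.trans (hη : ∀ n, 0 < η n) (h : SeqDominates ξ η) (h' : SeqDominates η ζ) :
    SeqDominates ξ ζ :=
  (h.atTop_mul_atTop₀ h').congr fun n => div_mul_div_cancel₀ (hη n).ne'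

theorem SeqEquiv.trans_dominates (hη : ∀ n, 0 < η n) (h : SeqEquiv ξ η) (h' : SeqDominates η ζ) :
    SeqDominates ξ ζ := by
  obtain ⟨c, hc, h⟩ := h
  exact (h.pos_mul_atTop hc h').congr fun n => div_mul_div_cancel₀ (hη n).ne'

theorem SeqDominates.trans_equiv (hη : ∀ n, 0 < η n) (h : SeqDominates ξ η) (h' : SeqEquiv η ζ) :
    SeqDominates ξ ζ := by
  obtain ⟨c, hc, h'⟩ := h'
  exact (Tendsto.atTop_mul_pos hc h h').congr fun n => div_mul_div_cancel₀ (hη n).ne'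

/-- Three comparable sequences have one of seven possible sets of largest elements; the first
alternative merges `{a}` with `{a, c}`. -/
theorem TotallyComparable.trichotomy {X : Set (ℕ → ℝ)} (hX : TotallyComparable X) {a b c : ℕ → ℝ}
    (ha : a ∈ X) (hb : b ∈ X) (hc : c ∈ X) (a0 : ∀ n, 0 < a n) (b0 : ∀ n, 0 < b n) :
    ((SeqDominates a b ∧ SeqDominates a c) ∨ (SeqEquiv a c ∧ SeqDominates c b)) ∨
      (SeqDominates b a ∧ SeqDominates b c) ∨ (SeqDominates c b ∧ SeqDominates c a) ∨
      (SeqEquiv a b ∧ SeqDominates b c) ∨ (SeqEquiv b c ∧ SeqDominates c a) ∨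
      (SeqEquiv a b ∧ SeqEquiv b c) := by
  rcases hX a ha b hb with hab | hab | hab
  · rcases hX b hb c hc with hbc | hbc | hbc
    · tauto
    · tauto
    · have := hbc.trans_equiv b0 hab.symm
      tauto
  · rcases hX a ha c hc with hac | hac | hac
    · have := hac.symm.trans_dominates a0 hab
      tauto
    · tauto
    · have := hac.trans a0 hab
      tauto
  · rcases hX b hb c hc with hbc | hbc | hbc
    · have := hbc.symm.trans_dominates b0 hab
      tauto
    · tauto
    · have := hbc.trans b0 hab
      tauto

end Comparison

/-! ### Expansions whose first vector vanishes. -/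

section Expansion

variable {Z : Type*} [NormedAddCommGroup Z] [NormedSpace ℝ Z]

theorem IsRelaxedExpansion.congr {u : ℕ → Z} {N : ℕ∞} {v : Z} {w w' : ℕ → Z} {Γ : ℕ → ℕ → ℝ}
    (h : IsRelaxedExpansion u N v w Γ) (hw : ∀ k, 1 ≤ k → w k = w' k) :
    IsRelaxedExpansion u N v w' Γ := by
  obtain ⟨r, h⟩ := h
  refine ⟨r, h.trivial_case, h.Γ_pos, h.Γ_one, h.Γ_succ, fun k hk hkN => ?_, fun k hk hkN n => ?_,
    fun K hK hKN n => ?_, fun K hK hKN => ?_⟩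
  · rw [← hw k hk]
    exact h.rem_tendsto k hk hkN
  · rw [h.expand k hk hkN n]
    congr 2
    exact Finset.sum_congr rfl fun j hj => by rw [hw j (Finset.mem_Ico.1 hj).1]
  · rw [← hw K hK]
    exact h.rem_last K hK hKN n
  · rw [← hw K hK]
    exact h.last_ne_zero K hK hKN

/-- A unit vector is not zero, so the expansion is not unitary, and in the degenerate case `M = 0`.
-/
theorem isDegenerate_of_first_eq_zero {u : ℕ → Z} {N : ℕ∞} {v : Z} {w : ℕ → Z} {Γ : ℕ → ℕ → ℝ}
    (hexp : IsUnitaryExpansion u N v w Γ ∨ (N = ⊤ ∧ IsDegenerateExpansion u v w Γ))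
    (hN : 1 ≤ N) (h : w 1 = 0) :
    N = ⊤ ∧ (∀ k : ℕ, 1 ≤ k → w k = 0) ∧ IsDegenerateExpansion u v (fun _ => 0) Γ := by
  rcases hexp with ⟨-, hu⟩ | ⟨rfl, hrel, M, hM, hM'⟩
  · have := hu 1 le_rfl (by exact_mod_cast hN)
    simp [h] at this
  · have hM0 : M = 0 := by
      by_contra hne
      have := hM 1 le_rfl (Nat.one_le_iff_ne_zero.2 hne)
      simp [h] at this
    subst hM0
    have hw (k : ℕ) (hk : 1 ≤ k) : w k = 0 := hM' k hk
    exact ⟨rfl, hw, hrel.congr hw, 0, fun k hk hk' => by lia, fun _ _ => rfl⟩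

end Expansion

/-! ### Matching orders in the steady state equation. -/

namespace NSE

variable {L : ℝ} [hL : Fact (0 < L)]

theorem tendsto_B {x y : ℕ → V L} {x₀ y₀ : V L} (hx : Tendsto x atTop (𝓝 x₀))
    (hy : Tendsto y atTop (𝓝 y₀)) (φ : V L) :
    Tendsto (fun n => B (x n) (y n) φ) atTop (𝓝 (B x₀ y₀ φ)) := by
  have h1 := hx.prodMk_nhds (hy.prodMk_nhds (tendsto_const_nhds (x := φ)))
  have h2 := continuous_B.tendsto (x₀, y₀, φ)
  have h3 := h2.comp h1
  exact h3

theorem tendsto_A {x : ℕ → V L} {x₀ : V L} (hx : Tendsto x atTop (𝓝 x₀)) (φ : V L) :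
    Tendsto (fun n => A (x n) φ) atTop (𝓝 (A x₀ φ)) :=
  ((continuous_A φ).tendsto x₀).comp hx

theorem tendsto_Bs {x : ℕ → V L} {x₀ : V L} (hx : Tendsto x atTop (𝓝 x₀)) (v φ : V L) :
    Tendsto (fun n => Bs v (x n) φ) atTop (𝓝 (Bs v x₀ φ)) :=
  (tendsto_B tendsto_const_nhds hx φ).add (tendsto_B hx tendsto_const_nhds φ)

theorem Bs_add_right (v x y : V L) : Bs v (x + y) = Bs v x + Bs v y := by
  simp only [Bs, B_add_left, B_add_right]
  abel

theorem Bs_smul_right (c : ℝ) (v x : V L) : Bs v (c • x) = c • Bs v x := by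
  simp only [Bs, B_smul_left, B_smul_right, smul_add]

/-- The equation satisfied by the deviation `x` of a steady state from `A⁻¹ g`. -/
theorem IsSteadyState.deviation {α : ℝ} {g : H L} {v x : V L} (h : IsSteadyState α g (v + x))
    (hv : A v = ofH g) : A x + α • (B v v + Bs v x + B x x) = 0 := by
  unfold IsSteadyState at h
  rw [← hv, A_add, add_assoc, add_eq_left] at h
  rw [← h]
  simp only [Bs, B_add_left, B_add_right]
  congr 2
  abel

theorem IsSteadyState.deviation_smul {α γ : ℝ} {g : H L} {v x : V L}
    (h : IsSteadyState α g (v + γ • x)) (hv : A v = ofH g) (φ : V L) :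
    γ * A x φ + α * (B v v φ + γ * Bs v x φ + γ ^ 2 * B x x φ) = 0 := by
  have := congrFun (h.deviation hv) φ
  simp only [A_smul, Bs_smul_right, B_smul_left, B_smul_right, Pi.add_apply, Pi.smul_apply,
    smul_eq_mul, Pi.zero_apply] at this
  linarith

section FirstOrder

variable {g : H L} {α γ : ℕ → ℝ} {v x₀ : V L} {x : ℕ → V L}

/-- Divide the equation for the deviation by `α`: every term except `B v v` tends to zero. -/
theorem B_base_eq_zero (hα : ∀ n, 0 < α n) (hα_lim : Tendsto α atTop atTop)
    (hv : A v = ofH g) (hγ_lim : Tendsto γ atTop (𝓝 0)) (hx : Tendsto x atTop (𝓝 x₀))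
    (hu : ∀ n, IsSteadyState (α n) g (v + γ n • x n)) : B v v = 0 := by
  funext φ
  have hlim : Tendsto (fun n => -((α n)⁻¹ * (γ n * A (x n) φ)) -
      (γ n * Bs v (x n) φ + γ n ^ 2 * B (x n) (x n) φ)) atTop
      (𝓝 (-(0 * (0 * A x₀ φ)) - (0 * Bs v x₀ φ + 0 ^ 2 * B x₀ x₀ φ))) :=
    ((tendsto_inv_atTop_zero.comp hα_lim).mul (hγ_lim.mul (tendsto_A hx φ))).neg.sub
      ((hγ_lim.mul (tendsto_Bs hx v φ)).add ((hγ_lim.pow 2).mul (tendsto_B hx hx φ)))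
  have hconst : Tendsto (fun _ : ℕ => B v v φ) atTop (𝓝 (B v v φ)) := tendsto_const_nhds
  rw [tendsto_nhds_unique hconst (hlim.congr fun n => ?_)]
  · simp
  · have h := (hu n).deviation_smul hv φ
    have := (hα n).ne'
    field_simp
    linarith

/-- With `B v v = 0`, divide by `α γ`; the terms in `A` and `B` keep the factors `1/α` and `γ`. -/
theorem Bs_first_eq_zero (hα : ∀ n, 0 < α n) (hα_lim : Tendsto α atTop atTop)
    (hv : A v = ofH g) (hγ : ∀ n, 0 < γ n) (hγ_lim : Tendsto γ atTop (𝓝 0))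
    (hx : Tendsto x atTop (𝓝 x₀)) (hu : ∀ n, IsSteadyState (α n) g (v + γ n • x n)) :
    Bs v x₀ = 0 := by
  have hB := B_base_eq_zero hα hα_lim hv hγ_lim hx hu
  funext φ
  have hlim : Tendsto (fun n => -((α n)⁻¹ * A (x n) φ) - γ n * B (x n) (x n) φ) atTop
      (𝓝 (-(0 * A x₀ φ) - 0 * B x₀ x₀ φ)) :=
    ((tendsto_inv_atTop_zero.comp hα_lim).mul (tendsto_A hx φ)).neg.sub
      (hγ_lim.mul (tendsto_B hx hx φ))
  rw [tendsto_nhds_unique (tendsto_Bs hx v φ) (hlim.congr fun n => ?_)]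
  · simp
  · have h := (hu n).deviation_smul hv φ
    rw [hB, Pi.zero_apply, zero_add] at h
    have h1 := (hα n).ne'
    have h2 := (hγ n).ne'
    have h3 : γ n * (A (x n) φ + α n * (Bs v (x n) φ + γ n * B (x n) (x n) φ)) = 0 := by
      linarith
    have h4 := (mul_eq_zero.1 h3).resolve_left h2
    field_simp
    linarith

end FirstOrder

/-- Test with `x` itself: the nonlinear term cancels and `l ‖x‖² = 0` remains. -/
theorem eq_zero_of_A_add_smul_B {l m : ℝ} (hl : 0 < l) {x : V L}
    (h : l • A x + m • B x x = 0) : x = 0 := by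
  have := congrFun h x
  simpa [A_self, B_self, hl.ne'] using this

theorem first_eq_zero_of_exact {g : H L} {α γ : ℝ} {v x : V L} (hv : A v = ofH g) (hγ : 0 < γ)
    (hB : B v v = 0) (hBs : Bs v x = 0) (h : IsSteadyState α g (v + γ • x)) : x = 0 := by
  refine eq_zero_of_A_add_smul_B hγ (m := α * γ ^ 2) ?_
  funext φ
  have := h.deviation_smul hv φ
  simp only [hB, hBs, Pi.zero_apply] at this
  simp only [Pi.add_apply, Pi.smul_apply, smul_eq_mul, Pi.zero_apply]
  linarith

/-- The equation at the order given by a sequence `d` that dominates the leading coefficients. -/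
theorem second_order_balance {g : H L} {α γ δ d : ℕ → ℝ} {v w₁ w₂ : V L} {x : ℕ → V L}
    {l m p : ℝ} (hv : A v = ofH g) (hB : B v v = 0) (hBs : Bs v w₁ = 0)
    (hγ : ∀ n, 0 < γ n) (hγ_lim : Tendsto γ atTop (𝓝 0))
    (hδ : Tendsto (fun n => δ n / γ n) atTop (𝓝 0)) (hx : Tendsto x atTop (𝓝 w₂))
    (hu : ∀ n, IsSteadyState (α n) g (v + (γ n • w₁ + δ n • x n)))
    (hl : Tendsto (fun n => γ n / d n) atTop (𝓝 l))
    (hm : Tendsto (fun n => α n * δ n / d n) atTop (𝓝 m))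
    (hp : Tendsto (fun n => α n * γ n ^ 2 / d n) atTop (𝓝 p)) :
    l • A w₁ + m • Bs v w₂ + p • B w₁ w₁ = 0 := by
  funext φ
  have hδ_lim : Tendsto δ atTop (𝓝 0) := by
    have := hδ.mul hγ_lim
    rw [zero_mul] at this
    exact this.congr fun n => div_mul_cancel₀ _ (hγ n).ne'
  -- The lower-order coefficients factor as `δ/d = (δ/γ)(γ/d)`, `αγδ/d = γ(αδ/d)` and `αδ²/d =
  -- δ(αδ/d)`, so each is a null sequence times a convergent one.
  have hlim := ((((hl.mul_const (A w₁ φ)).add ((hδ.mul hl).mul (tendsto_A hx φ))).add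
    (hm.mul (tendsto_Bs hx v φ))).add (hp.mul_const (B w₁ w₁ φ))).add
    (((hγ_lim.mul hm).mul (tendsto_Bs hx w₁ φ)).add ((hδ_lim.mul hm).mul (tendsto_B hx hx φ)))
  have hzero := tendsto_nhds_unique (hlim.congr (f₂ := fun _ => (0 : ℝ)) fun n => ?_)
    tendsto_const_nhds
  · simpa using hzero
  · have h := congrFun ((hu n).deviation hv) φ
    simp only [hB, Bs_add_right, Bs_smul_right, hBs, A_add, A_smul, B_add_left, B_add_right,
      B_smul_left, B_smul_right, Pi.add_apply, Pi.smul_apply, smul_eq_mul, Pi.zero_apply] at h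
    have e : Bs w₁ (x n) φ = B w₁ (x n) φ + B (x n) w₁ φ := rfl
    have hg := (hγ n).ne'
    symm
    -- Starting from `0 / d n` avoids any assumption that `d n` is nonzero.
    calc (0 : ℝ) = 0 / d n := (zero_div _).symm
      _ = _ := by
        rw [← h, e]
        field_simp
        ring

end NSE

end

/-! ### The main theorem. -/

theorem theorem4p7 (L : ℝ) [Fact (0 < L)]
    (g : NSE.H L) (hg : g ≠ 0)
    (α : ℕ → ℝ) (hα : ∀ n, 0 < α n) (hα_lim : Tendsto α atTop atTop)
    (u : ℕ → NSE.V L) (hu : ∀ n, NSE.IsSteadyState (α n) g (u n))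
    (N : ℕ∞) (v : NSE.V L) (w : ℕ → NSE.V L) (Γ : ℕ → ℕ → ℝ)
    (hexp : IsUnitaryExpansion u N v w Γ ∨ (N = ⊤ ∧ IsDegenerateExpansion u v w Γ))
    (hcomp : TotallyComparable (coefficientSequences α N Γ))
    (hN : N ≠ 0)
    (hv : NSE.A v = NSE.ofH g) :
    NSE.Bs v (w 1) = 0 ∧ 2 ≤ N ∧
    ∀ a b c : ℕ → ℝ, a = Γ 1 → b = (fun n => α n * Γ 2 n) → c = (fun n => α n * Γ 1 n ^ 2) →
      -- the six scenarios exhaust all possibilities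
      (((SeqDominates a b ∧ SeqDominates a c) ∨ (SeqEquiv a c ∧ SeqDominates c b)) ∨
        (SeqDominates b a ∧ SeqDominates b c) ∨
        (SeqDominates c b ∧ SeqDominates c a) ∨
        (SeqEquiv a b ∧ SeqDominates b c) ∨
        (SeqEquiv b c ∧ SeqDominates c a) ∨
        (SeqEquiv a b ∧ SeqEquiv b c)) ∧
      -- (i)
      ((SeqDominates a b ∧ SeqDominates a c) ∨ (SeqEquiv a c ∧ SeqDominates c b) →
        N = ⊤ ∧ (∀ k : ℕ, 1 ≤ k → w k = 0) ∧ IsDegenerateExpansion u v (fun _ => 0) Γ) ∧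
      -- (ii)
      (SeqDominates b a ∧ SeqDominates b c → NSE.Bs v (w 2) = 0) ∧
      -- (iii)
      (SeqDominates c b ∧ SeqDominates c a → NSE.B (w 1) (w 1) = 0) ∧
      -- (iv)
      (SeqEquiv a b ∧ SeqDominates b c →
        ∃ μ : ℝ, 0 < μ ∧ NSE.A (w 1) + μ • NSE.Bs v (w 2) = 0) ∧
      -- (v)
      (SeqEquiv b c ∧ SeqDominates c a →
        ∃ μ : ℝ, 0 < μ ∧ NSE.Bs v (w 2) + μ • NSE.B (w 1) (w 1) = 0) ∧
      -- (vi)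
      (SeqEquiv a b ∧ SeqEquiv b c →
        ∃ μ₁ μ₂ : ℝ, 0 < μ₁ ∧ 0 < μ₂ ∧
          NSE.A (w 1) + μ₁ • NSE.Bs v (w 2) + μ₂ • NSE.B (w 1) (w 1) = 0) := by
  have h1N : 1 ≤ N := Order.one_le_iff_pos.2 (pos_iff_ne_zero.2 hN)
  obtain ⟨r, hr⟩ : IsRelaxedExpansion u N v w Γ := by
    rcases hexp with h | ⟨rfl, h⟩
    · exact h.1
    · exact h.1
  have h1N' : ((1 : ℕ) : ℕ∞) ≤ N := by exact_mod_cast h1N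
  have hγ := hr.Γ_pos 1 le_rfl h1N'
  have hγ_lim := hr.Γ_one h1N
  have hx := hr.rem_tendsto 1 le_rfl h1N'
  have hu1 (n : ℕ) : NSE.IsSteadyState (α n) g (v + Γ 1 n • r 1 n) := by
    have := hu n
    rwa [hr.expand 1 le_rfl h1N' n, Finset.Ico_self, Finset.sum_empty, add_zero] at this
  have hB := NSE.B_base_eq_zero hα hα_lim hv hγ_lim hx hu1
  have hBs := NSE.Bs_first_eq_zero hα hα_lim hv hγ hγ_lim hx hu1
  -- If `N = 1`, the equation holds exactly with `r 1 n = w 1`, so a single index `n` suffices for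
  -- the contradiction.
  have h2N : 2 ≤ N := by
    by_contra hlt
    have hN1 : N = (1 : ℕ) := by
      refine le_antisymm ?_ h1N'
      rw [not_le, ← one_add_one_eq_two] at hlt
      exact_mod_cast Order.le_of_lt_add_one hlt
    have h0 := hu1 0
    rw [hr.rem_last 1 le_rfl hN1 0] at h0
    exact hr.last_ne_zero 1 le_rfl hN1 (NSE.first_eq_zero_of_exact hv (hγ 0) hB hBs h0)
  refine ⟨hBs, h2N, ?_⟩
  rintro a b c rfl rfl rfl
  have h2N' : ((2 : ℕ) : ℕ∞) ≤ N := by exact_mod_cast h2N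
  have hδ := hr.Γ_pos 2 one_le_two h2N'
  have hratio := hr.Γ_succ 1 le_rfl (lt_of_lt_of_le (by norm_num) h2N)
  have hu2 (n : ℕ) : NSE.IsSteadyState (α n) g (v + (Γ 1 n • w 1 + Γ 2 n • r 2 n)) := by
    have := hu n
    rwa [hr.expand 2 one_le_two h2N' n, show Finset.Ico 1 2 = {1} from rfl,
      Finset.sum_singleton, add_assoc] at this
  have a0 := hγ
  have b0 (n : ℕ) : 0 < α n * Γ 2 n := mul_pos (hα n) (hδ n)
  have c0 (n : ℕ) : 0 < α n * Γ 1 n ^ 2 := mul_pos (hα n) (pow_pos (hγ n) 2)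
  -- The scenarios differ only in `d`, which is always a largest one of the three leading
  -- coefficients, and in the limits `l`, `m`, `p` of their quotients by it.
  have bal {d : ℕ → ℝ} {l m p : ℝ} := NSE.second_order_balance (d := d) (l := l) (m := m) (p := p)
    hv hB hBs hγ hγ_lim hratio (hr.rem_tendsto 2 one_le_two h2N') hu2
  have self {ξ : ℕ → ℝ} (h : ∀ n, 0 < ξ n) : Tendsto (fun n => ξ n / ξ n) atTop (𝓝 1) :=
    tendsto_const_nhds.congr fun n => (div_self (h n).ne').symm
  refine ⟨?_, ?_, ?_, ?_, ?_, ?_, ?_⟩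
  · refine hcomp.trichotomy ?_ ?_ ?_ a0 b0
    · exact Or.inr (Or.inr (Or.inl ⟨1, le_rfl, h1N', Or.inl rfl⟩))
    · exact Or.inr (Or.inr (Or.inl ⟨2, one_le_two, h2N', Or.inr rfl⟩))
    · exact Or.inr (Or.inr (Or.inr ⟨1, 1, le_rfl, h1N', le_rfl, h1N', by
        funext n; ring⟩))
  · intro h
    refine isDegenerate_of_first_eq_zero hexp h1N ?_
    rcases h with ⟨hab, hac⟩ | ⟨⟨l, hl, hac⟩, hcb⟩
    · refine NSE.eq_zero_of_A_add_smul_B one_pos (m := 0) ?_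
      simpa using bal (self a0) hab.tendsto_inv hac.tendsto_inv
    -- Here `d` is `α Γ₁²` and `l` is the positive limit of `Γ₁ / (α Γ₁²)`, so the `A` term
    -- survives.
    · refine NSE.eq_zero_of_A_add_smul_B hl (m := 1) ?_
      simpa using bal hac hcb.tendsto_inv (self c0)
  · rintro ⟨hba, hbc⟩
    simpa using bal hba.tendsto_inv (self b0) hbc.tendsto_inv
  · rintro ⟨hcb, hca⟩
    simpa using bal hca.tendsto_inv hcb.tendsto_inv (self c0)
  · rintro ⟨hab, hbc⟩
    -- Normalizing by `Γ₁` gives `A (w 1)` coefficient one; `μ` is the limit of `α Γ₂ / Γ₁`.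
    obtain ⟨m, hm, hba⟩ := hab.symm
    have hac := hab.trans_dominates b0 hbc
    exact ⟨m, hm, by simpa using bal (self a0) hba hac.tendsto_inv⟩
  · rintro ⟨hbc, hca⟩
    obtain ⟨p, hp, hcb⟩ := hbc.symm
    have hba := hbc.trans_dominates c0 hca
    exact ⟨p, hp, by simpa using bal hba.tendsto_inv (self b0) hcb⟩
  · rintro ⟨hab, hbc⟩
    obtain ⟨m, hm, hba⟩ := hab.symm
    obtain ⟨p, hp, hca⟩ := (hab.trans b0 hbc).symm
    exact ⟨m, p, hm, hp, by simpa using bal (self a0) hba hca⟩
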